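/- A graph is $(C_4,\text{diamond})$-free if it contains neither the cycle $C_4$ on four vertices nor the diamond ($K_4$ minus one edge) as an induced subgraph. A finite graph is $3$-connected if it has more than three vertices and remains connected whenever at most two vertices are removed. For a graph $G$ on $n$ vertices and $1\le k\le n-1$, the $k$-token graph $F_k(G)$ is the graph whose vertices are the $k$-element subsets of $V(G)$, two of them being adjacent if their symmetric difference is a pair of adjacent vertices of $G$. There is a polynomial-time algorithm which, given as its only input a graph $F$ that is isomorphic to $F_k(G)$ for some $3$-connected $(C_4,\text{diamond})$-free graph $G$ on $n$ vertices and some $1\le k\le n-1$ (neither $G$, $n$, $k$ nor an isomorphism $F\to F_k(G)$ being given), computes a graph $H$ isomorphic to $G$. -/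

import Mathlib

open scoped SimpleGraph

/-! ### Graphs -/

/-- The `k`-token graph of `G`: its vertices are the sets of `k` vertices of `G`, and two of them
are adjacent if their symmetric difference is a pair of adjacent vertices of `G`. -/
def tokenGraph {V : Type*} [DecidableEq V] (G : SimpleGraph V) (k : ℕ) :
    SimpleGraph {A : Finset V // A.card = k} where
  Adj A B := ∃ a b : V, G.Adj a b ∧ symmDiff A.1 B.1 = {a, b}
  symm := ⟨by
    rintro A B ⟨a, b, hab, h⟩
    exact ⟨a, b, hab, by rw [symmDiff_comm, h]⟩⟩
  loopless := ⟨by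
    rintro A ⟨a, b, -, h⟩
    have ha : a ∈ ({a, b} : Finset V) := by simp
    rw [← h, symmDiff_self] at ha
    simp at ha⟩

/-- The diamond: the complete graph on four vertices minus one edge. -/
def diamondGraph : SimpleGraph (Fin 4) :=
  (⊤ : SimpleGraph (Fin 4)).deleteEdges {s(0, 1)}

/-- A graph is (`C₄`, diamond)-free if it contains neither the cycle on four vertices nor the
diamond as an induced subgraph. -/
def IsC4DiamondFree {V : Type*} (G : SimpleGraph V) : Prop :=
  ¬ (SimpleGraph.cycleGraph 4 ⊴ G) ∧ ¬ (diamondGraph ⊴ G)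

/-- A finite graph is `c`-connected if it has more than `c` vertices and remains connected
whenever fewer than `c` vertices are removed. -/
def IsVertexConnected {V : Type*} [Fintype V] (G : SimpleGraph V) (c : ℕ) : Prop :=
  c < Fintype.card V ∧
    ∀ S : Finset V, S.card < c → (G.induce {v : V | v ∉ S}).Connected

/-! ### Random access machines

A random access machine has registers and arrays of registers, named by natural numbers; each
register and each array cell holds a natural number. A program mentions finitely many names. The
arithmetic instructions are addition and truncated subtraction only, and every instruction and every
test costs one step. The bit length of the largest number in use thus grows by at most one in a
step (apart from the constants in the program), so polynomial time on this machine agrees with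
polynomial time on Turing machines. -/

namespace RAM

/-- A memory state: the contents of the registers and of the arrays. -/
structure State where
  /-- `reg x` is the content of register `x`. -/
  reg : ℕ → ℕ
  /-- `arr a i` is the content of cell `i` of array `a`. -/
  arr : ℕ → ℕ → ℕ

/-- Write `v` into register `x`. -/
def State.setReg (s : State) (x v : ℕ) : State :=
  { s with reg := Function.update s.reg x v }

/-- Write `v` into cell `i` of array `a`. -/
def State.setArr (s : State) (a i v : ℕ) : State :=
  { s with arr := Function.update s.arr a (Function.update (s.arr a) i v) }

/-- Programs. -/
inductive Prog : Type
  /-- `x := c` for a constant `c` -/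
  | const (x c : ℕ)
  /-- `x := y` -/
  | copy (x y : ℕ)
  /-- `x := y + z` -/
  | add (x y z : ℕ)
  /-- `x := y - z`, which is `0` if `y ≤ z` -/
  | sub (x y z : ℕ)
  /-- `x := a[y]` -/
  | load (x a y : ℕ)
  /-- `a[x] := y` -/
  | store (a x y : ℕ)
  /-- first `P`, then `Q` -/
  | seq (P Q : Prog)
  /-- `P` if `x ≠ 0`, and `Q` otherwise -/
  | cond (x : ℕ) (P Q : Prog)
  /-- repeat `P` as long as `x ≠ 0` -/
  | loop (x : ℕ) (P : Prog)

/-- `Runs P s s' t`: started in state `s`, the program `P` halts in state `s'` after exactly `t`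
steps. -/
inductive Runs : Prog → State → State → ℕ → Prop
  | const (x c : ℕ) (s : State) : Runs (.const x c) s (s.setReg x c) 1
  | copy (x y : ℕ) (s : State) : Runs (.copy x y) s (s.setReg x (s.reg y)) 1
  | add (x y z : ℕ) (s : State) : Runs (.add x y z) s (s.setReg x (s.reg y + s.reg z)) 1
  | sub (x y z : ℕ) (s : State) : Runs (.sub x y z) s (s.setReg x (s.reg y - s.reg z)) 1
  | load (x a y : ℕ) (s : State) : Runs (.load x a y) s (s.setReg x (s.arr a (s.reg y))) 1
  | store (a x y : ℕ) (s : State) : Runs (.store a x y) s (s.setArr a (s.reg x) (s.reg y)) 1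
  | seq {P Q : Prog} {s s₁ s₂ : State} {t₁ t₂ : ℕ} (h₁ : Runs P s s₁ t₁) (h₂ : Runs Q s₁ s₂ t₂) :
      Runs (.seq P Q) s s₂ (t₁ + t₂)
  | cond_true {x : ℕ} {P Q : Prog} {s s₁ : State} {t : ℕ} (hx : s.reg x ≠ 0)
      (h : Runs P s s₁ t) : Runs (.cond x P Q) s s₁ (t + 1)
  | cond_false {x : ℕ} {P Q : Prog} {s s₁ : State} {t : ℕ} (hx : s.reg x = 0)
      (h : Runs Q s s₁ t) : Runs (.cond x P Q) s s₁ (t + 1)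
  | loop_done {x : ℕ} {P : Prog} {s : State} (hx : s.reg x = 0) : Runs (.loop x P) s s 1
  | loop_step {x : ℕ} {P : Prog} {s s₁ s₂ : State} {t₁ t₂ : ℕ} (hx : s.reg x ≠ 0)
      (h₁ : Runs P s s₁ t₁) (h₂ : Runs (.loop x P) s₁ s₂ t₂) :
      Runs (.loop x P) s s₂ (t₁ + t₂ + 1)

/-- The state `s` holds the graph `H` on the vertices `0, …, m - 1`: register `0` contains `m`, and
array `0` contains the adjacency matrix of `H`, row by row. -/
def Holds {m : ℕ} (s : State) (H : SimpleGraph (Fin m)) : Prop :=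
  s.reg 0 = m ∧ ∀ i j : Fin m,
    (H.Adj i j → s.arr 0 (i * m + j) = 1) ∧ (¬ H.Adj i j → s.arr 0 (i * m + j) = 0)

open Classical in
/-- The initial state on input `F`: register `0` contains the number of vertices of `F`, array `0`
contains the adjacency matrix of `F`, row by row, and everything else is `0`. -/
noncomputable def input {N : ℕ} (F : SimpleGraph (Fin N)) : State where
  reg x := if x = 0 then N else 0
  arr a c := if a = 0 ∧ ∃ i j : Fin N, F.Adj i j ∧ c = i * N + j then 1 else 0

end RAM

/-! An edge of a token graph moves one token along an edge of `G`; call that edge of `G` its label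
(`lab`). The reconstruction recovers the labels up to renaming, then the way they meet, and hence
`G`.

In a (`C₄`, diamond)-free graph two nonadjacent vertices have at most one common neighbour.
Therefore the induced four-cycles of the token graph are exactly the squares in which two tokens
move independently along disjoint edges, and opposite sides have equal labels
(`OppositeEdges.lab_eq`, `oppositeEdges_of_lab_eq`). Conversely, two edges with label `{a, c}`
differ only in the positions of the other `k - 1` tokens. As `G` minus `a` and `c` is connected,
these tokens can be slid from one position to the other, each slide being a square
(`sameLabel_iff`). So equality of labels is the equivalence generated by opposite sides of induced
four-cycles and by reversal, which refers to the token graph alone.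

A path of length two lying in no such square has labels that share exactly one vertex of `G`
(`wedge_iff`), and for `k + 2 ≤ n` every vertex arises from such a wedge. An edge of `G` contains
the vertex `b` of a wedge if it is one of the two labels, or if it meets both without closing a
triangle; triangles of labels appear as triangles of the token graph (`inc_iff`). This decides when
two wedges give equal or adjacent vertices. The remaining case `k = n - 1` becomes `k = 1` by taking
complements.

For the running time, each relation is a fixed formula with quantifiers over the `N` vertices of the
input, apart from one transitive closure on pairs; nested loops evaluate all of it. Since `n ≤ N`, a
list of the vertices of `G` can be indexed by numbers below `N`. -/

namespace RAM

/-! ### Timed correctness assertions with a register frame -/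

/-- Started in `s`, the program `P` halts after at most `T` steps in a state that satisfies `Q`, and
it leaves the registers below `b` as they were. -/
def Exec (P : Prog) (b T : ℕ) (s : State) (Q : State → Prop) : Prop :=
  ∃ s' t, Runs P s s' t ∧ t ≤ T ∧ (∀ r < b, s'.reg r = s.reg r) ∧ Q s'

/-- The frame is handed to the weakened postcondition, so facts about low registers need not be
carried in `Q`. -/
theorem Exec.mono {P : Prog} {b b' T T' : ℕ} {s : State} {Q Q' : State → Prop}
    (h : Exec P b T s Q) (hb : b' ≤ b) (hT : T ≤ T')
    (hQ : ∀ s', (∀ r < b, s'.reg r = s.reg r) → Q s' → Q' s') : Exec P b' T' s Q' := by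
  obtain ⟨s', t, h1, h2, h3, h4⟩ := h
  exact ⟨s', t, h1, h2.trans hT, fun r hr => h3 r (hr.trans_le hb), hQ s' h3 h4⟩

theorem exec_seq {P P' : Prog} {b T T' : ℕ} {s : State} {Q : State → Prop}
    (h : Exec P b T s fun s₁ => Exec P' b T' s₁ Q) : Exec (.seq P P') b (T + T') s Q := by
  obtain ⟨s₁, t, h1, h2, h3, s₂, t', h1', h2', h3', hQ⟩ := h
  exact ⟨s₂, t + t', .seq h1 h1', add_le_add h2 h2', fun r hr => (h3' r hr).trans (h3 r hr), hQ⟩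

theorem setReg_reg (s : State) (x v r : ℕ) :
    (s.setReg x v).reg r = if r = x then v else s.reg r := by
  simp [State.setReg, Function.update_apply]

@[simp]
theorem setReg_arr (s : State) (x v : ℕ) : (s.setReg x v).arr = s.arr := rfl

@[simp]
theorem setArr_reg (s : State) (a i v : ℕ) : (s.setArr a i v).reg = s.reg := rfl

theorem setArr_arr (s : State) (a i v c j : ℕ) :
    (s.setArr a i v).arr c j = if c = a ∧ j = i then v else s.arr c j := by
  by_cases h : c = a
  · subst h
    simp [State.setArr, Function.update_apply]
  · simp [State.setArr, h]

theorem setReg_frame {b x : ℕ} (s : State) (v : ℕ) (hx : b ≤ x) :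
    ∀ r < b, (s.setReg x v).reg r = s.reg r := fun r hr => by
  rw [setReg_reg, if_neg (by omega)]

theorem exec_const {b x c : ℕ} {s : State} {Q : State → Prop} (hx : b ≤ x)
    (h : Q (s.setReg x c)) : Exec (.const x c) b 1 s Q :=
  ⟨_, _, .const x c s, le_rfl, setReg_frame s _ hx, h⟩

theorem exec_copy {b x y : ℕ} {s : State} {Q : State → Prop} (hx : b ≤ x)
    (h : Q (s.setReg x (s.reg y))) : Exec (.copy x y) b 1 s Q :=
  ⟨_, _, .copy x y s, le_rfl, setReg_frame s _ hx, h⟩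

theorem exec_add {b x y z : ℕ} {s : State} {Q : State → Prop} (hx : b ≤ x)
    (h : Q (s.setReg x (s.reg y + s.reg z))) : Exec (.add x y z) b 1 s Q :=
  ⟨_, _, .add x y z s, le_rfl, setReg_frame s _ hx, h⟩

theorem exec_sub {b x y z : ℕ} {s : State} {Q : State → Prop} (hx : b ≤ x)
    (h : Q (s.setReg x (s.reg y - s.reg z))) : Exec (.sub x y z) b 1 s Q :=
  ⟨_, _, .sub x y z s, le_rfl, setReg_frame s _ hx, h⟩

theorem exec_load {b x a y : ℕ} {s : State} {Q : State → Prop} (hx : b ≤ x)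
    (h : Q (s.setReg x (s.arr a (s.reg y)))) : Exec (.load x a y) b 1 s Q :=
  ⟨_, _, .load x a y s, le_rfl, setReg_frame s _ hx, h⟩

theorem exec_store {b a x y : ℕ} {s : State} {Q : State → Prop}
    (h : Q (s.setArr a (s.reg x) (s.reg y))) : Exec (.store a x y) b 1 s Q :=
  ⟨_, _, .store a x y s, le_rfl, fun _ _ => rfl, h⟩

theorem exec_cond {b x T : ℕ} {P P' : Prog} {s : State} {Q : State → Prop}
    (h1 : s.reg x ≠ 0 → Exec P b T s Q) (h2 : s.reg x = 0 → Exec P' b T s Q) :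
    Exec (.cond x P P') b (T + 1) s Q := by
  by_cases hx : s.reg x = 0
  · obtain ⟨s', t, ha, hb, hc⟩ := h2 hx
    exact ⟨s', t + 1, .cond_false hx ha, by omega, hc⟩
  · obtain ⟨s', t, ha, hb, hc⟩ := h1 hx
    exact ⟨s', t + 1, .cond_true hx ha, by omega, hc⟩

/-! ### Bounded loops -/

/-- Run `body` with register `b` going through the numbers below the content of register `0`.
Register `b + 1` is a counter, and register `c` is scratch space. -/
def forP (b c : ℕ) (body : Prog) : Prog :=
  .seq (.copy (b + 1) 0) <| .seq (.const b 0) <| .loop (b + 1) <|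
    .seq body <| .seq (.const c 1) <| .seq (.add b b c) (.sub (b + 1) (b + 1) c)

/-- `hloc` makes the invariant blind to the loop variable, the counter and the scratch register, so
the bookkeeping cannot break it. A round costs the body, three instructions and a test; the final
`3` is two initialisations and the last test. -/
theorem exec_for {body : Prog} {b c T : ℕ} {s : State} {Inv : ℕ → State → Prop}
    (hc : b + 2 ≤ c)
    (hloc : ∀ i s s', s'.arr = s.arr → (∀ r, b + 2 ≤ r → r < c → s'.reg r = s.reg r) →
      Inv i s → Inv i s')
    (h0 : Inv 0 s)
    (hbody : ∀ i < s.reg 0, ∀ s₁, (∀ r < b, s₁.reg r = s.reg r) → s₁.reg b = i → Inv i s₁ →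
      Exec body (b + 2) T s₁ (Inv (i + 1))) :
    Exec (forP b c body) b (s.reg 0 * (T + 4) + 3) s (Inv (s.reg 0)) := by
  -- Induction on the number `d` of rounds left; `i + d` stays constant.
  have key : ∀ d i s₁, i + d = s.reg 0 → (∀ r < b, s₁.reg r = s.reg r) → s₁.reg b = i →
      s₁.reg (b + 1) = d → Inv i s₁ →
      Exec (.loop (b + 1) <| .seq body <| .seq (.const c 1) <| .seq (.add b b c)
        (.sub (b + 1) (b + 1) c)) b (d * (T + 4) + 1) s₁ (Inv (s.reg 0)) := by
    intro d
    induction d with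
    | zero =>
      intro i s₁ hi hf _ h1 hI
      exact ⟨s₁, 1, .loop_done h1, by omega, fun _ _ => rfl, by simpa [← hi] using hI⟩
    | succ d ih =>
      intro i s₁ hi hf h2 h1 hI
      have hstep : Exec (.seq body <| .seq (.const c 1) <| .seq (.add b b c)
          (.sub (b + 1) (b + 1) c)) b (T + (1 + (1 + 1))) s₁ (fun s₂ => s₂.reg b = i + 1 ∧
            s₂.reg (b + 1) = d ∧ Inv (i + 1) s₂) := by
        refine exec_seq ((hbody i (by omega) s₁ hf h2 hI).mono (by omega) le_rfl ?_)
        intro s₂ hs₂ hI₂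
        refine exec_seq (exec_const (by omega) (exec_seq (exec_add (by omega)
          (exec_sub (by omega) ?_))))
        have e1 := hs₂ b (by omega)
        have e2 := hs₂ (b + 1) (by omega)
        refine ⟨?_, ?_, hloc _ s₂ _ rfl ?_ hI₂⟩
        · simp [setReg_reg, show b ≠ c by omega, e1, h2]
        · simp [setReg_reg, show b + 1 ≠ c by omega, show c ≠ b by omega, e2, h1]
        · intro r hr hr'
          simp only [setReg_reg]
          rw [if_neg (by omega), if_neg (by omega), if_neg (by omega)]
      obtain ⟨s₂, t, r1, r2, r3, g1, g2, g3⟩ := hstep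
      obtain ⟨s₃, t', q1, q2, q3, q4⟩ := ih (i + 1) s₂ (by omega)
        (fun r hr => (r3 r hr).trans (hf r hr)) g1 g2 g3
      refine ⟨s₃, t + t' + 1, .loop_step (by omega) r1 q1, ?_,
        fun r hr => (q3 r hr).trans (r3 r hr), q4⟩
      rw [Nat.succ_mul]
      omega
  have := exec_seq (exec_copy (b := b) (x := b + 1) (y := 0) (s := s) (by omega)
    (exec_seq (exec_const (x := b) (c := 0) le_rfl (key (s.reg 0) 0 _ (by omega) ?_ ?_ ?_ ?_))))
  · exact this.mono le_rfl (by omega) fun _ _ h => h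
  · intro r hr
    simp only [setReg_reg]
    rw [if_neg (by omega), if_neg (by omega)]
  · simp [setReg_reg]
  · simp [setReg_reg]
  · refine hloc _ s _ rfl ?_ h0
    intro r hr hr'
    simp only [setReg_reg]
    rw [if_neg (by omega), if_neg (by omega)]

/-! ### Codes of tuples -/

/-- The number with the digits `l` in base `n`. -/
def code (n : ℕ) (l : List ℕ) : ℕ :=
  l.foldl (fun c x => c * n + x) 0

/-- Replace `c` by `c * n + x`, where `c`, `n`, `x` are the contents of the registers `b`, `base`,
`v`. -/
def digitP (base v b : ℕ) : Prog :=
  .seq (.const (b + 1) 0) <| .seq (.copy (b + 2) base) <| .seq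
    (.loop (b + 2) <| .seq (.add (b + 1) (b + 1) b) <| .seq (.const (b + 3) 1)
      (.sub (b + 2) (b + 2) (b + 3)))
    (.add b (b + 1) v)

/-- The machine cannot multiply, so the product is a repeated addition and the time is linear in the
base. -/
theorem exec_digitP {base v b : ℕ} {s : State} (h1 : base < b) (h2 : v < b) :
    Exec (digitP base v b) b (4 * s.reg base + 4) s fun s' =>
      s'.arr = s.arr ∧ s'.reg b = s.reg b * s.reg base + s.reg v := by
  have key : ∀ d s₁, s₁.reg (b + 2) = d → Exec (.loop (b + 2) <| .seq (.add (b + 1) (b + 1) b) <|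
      .seq (.const (b + 3) 1) (.sub (b + 2) (b + 2) (b + 3))) (b + 1) (d * 4 + 1) s₁ fun s' =>
      s'.arr = s₁.arr ∧ s'.reg (b + 1) = s₁.reg (b + 1) + s₁.reg b * d := by
    intro d
    induction d with
    | zero =>
      intro s₁ h
      exact ⟨s₁, 1, .loop_done h, le_rfl, fun _ _ => rfl, rfl, by simp⟩
    | succ d ih =>
      intro s₁ h
      have hstep : Exec (.seq (.add (b + 1) (b + 1) b) <| .seq (.const (b + 3) 1)
          (.sub (b + 2) (b + 2) (b + 3))) (b + 1) (1 + (1 + 1)) s₁ fun s₂ =>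
          s₂.arr = s₁.arr ∧ s₂.reg (b + 1) = s₁.reg (b + 1) + s₁.reg b ∧ s₂.reg (b + 2) = d := by
        refine exec_seq (exec_add (by omega) (exec_seq (exec_const (by omega)
          (exec_sub (by omega) ?_))))
        simp [setReg_reg, h]
      obtain ⟨s₂, t, r1, r2, r3, g1, g2, g3⟩ := hstep
      obtain ⟨s₃, t', q1, q2, q3, q4, q5⟩ := ih s₂ g3
      refine ⟨s₃, t + t' + 1, .loop_step (by omega) r1 q1, by omega,
        fun r hr => (q3 r hr).trans (r3 r hr), q4.trans g1, ?_⟩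
      rw [q5, g2, r3 b (by omega)]
      ring
  refine Exec.mono (exec_seq (exec_const (by omega) (exec_seq (exec_copy (by omega) (exec_seq
    ((key _ _ rfl).mono (by omega) le_rfl (Q' := fun s₂ => Exec _ _ 1 s₂ _) ?_)))))) le_rfl ?_
    fun _ _ h => h
  · rintro s' hf ⟨ha, hr⟩
    refine exec_add le_rfl ⟨by simp [ha], ?_⟩
    rw [setReg_reg, if_pos rfl, hr, hf v (by omega)]
    simp only [setReg_reg]
    simp [show v ≠ b + 2 by omega, show v ≠ b + 1 by omega, show base ≠ b + 1 by omega]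
  · simp [setReg_reg, show base ≠ b + 1 by omega]
    omega

/-- Append the contents of the registers `vs` to the digits of the number in register `b`. -/
def digitsP (base : ℕ) : List ℕ → ℕ → Prog
  | [], b => .copy b b
  | v :: vs, b => .seq (digitP base v b) (digitsP base vs b)

theorem exec_digitsP {base b : ℕ} (h1 : base < b) (vs : List ℕ) (h2 : ∀ v ∈ vs, v < b)
    (s : State) :
    Exec (digitsP base vs b) b (vs.length * (4 * s.reg base + 4) + 1) s fun s' =>
      s'.arr = s.arr ∧
        s'.reg b = (vs.map s.reg).foldl (fun c x => c * s.reg base + x) (s.reg b) := by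
  induction vs generalizing s with
  | nil => exact (exec_copy le_rfl ⟨rfl, by simp [setReg_reg]⟩).mono le_rfl (by simp) fun _ _ h => h
  | cons v vs ih =>
    have hv : v < b := h2 v (by simp)
    have hvs : ∀ v ∈ vs, v < b := fun v hv => h2 v (by simp [hv])
    refine Exec.mono (exec_seq ((exec_digitP h1 hv).mono le_rfl le_rfl
      (Q' := fun s₂ => Exec _ _ (vs.length * (4 * s.reg base + 4) + 1) s₂ _) ?_)) le_rfl ?_
      fun _ _ h => h
    · rintro s₁ hf ⟨ha, hr⟩
      refine (ih hvs s₁).mono le_rfl (by rw [hf base h1]) ?_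
      rintro s₂ hf₂ ⟨ha₂, hr₂⟩
      refine ⟨ha₂.trans ha, ?_⟩
      have : vs.map s₁.reg = vs.map s.reg := List.map_congr_left fun x hx => hf x (hvs x hx)
      rw [hr₂, hr, this, hf base h1]
      rfl
    · simp only [List.length_cons]
      linarith

/-- Put the code of the contents of the registers `vs` into register `b`. -/
def codeP (base : ℕ) (vs : List ℕ) (b : ℕ) : Prog :=
  .seq (.const b 0) (digitsP base vs b)

theorem exec_codeP {base b : ℕ} (h1 : base < b) (vs : List ℕ) (h2 : ∀ v ∈ vs, v < b)
    (s : State) :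
    Exec (codeP base vs b) b (vs.length * (4 * s.reg base + 4) + 2) s fun s' =>
      s'.arr = s.arr ∧ s'.reg b = code (s.reg base) (vs.map s.reg) := by
  have hf := setReg_frame s 0 (le_refl b)
  refine Exec.mono (exec_seq (exec_const le_rfl
    ((exec_digitsP h1 vs h2 _).mono le_rfl (T' := vs.length * (4 * s.reg base + 4) + 1)
      (by rw [hf base h1]) ?_))) le_rfl (by omega) fun _ _ h => h
  rintro s₁ hf₁ ⟨ha, hr⟩
  refine ⟨ha, ?_⟩
  have : vs.map (s.setReg b 0).reg = vs.map s.reg := List.map_congr_left fun x hx => hf x (h2 x hx)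
  rw [hr, this, hf base h1, setReg_reg, if_pos rfl]
  rfl

theorem code_append (n : ℕ) (l : List ℕ) (x : ℕ) : code n (l ++ [x]) = code n l * n + x := by
  simp [code]

/-- The last digit is the remainder modulo `n`, and the quotient is the code of the rest. Equal
lengths are required because of leading zeros. -/
theorem code_inj {n : ℕ} {l l' : List ℕ} (h : l.length = l'.length) (hl : ∀ x ∈ l, x < n)
    (hl' : ∀ x ∈ l', x < n) (hc : code n l = code n l') : l = l' := by
  induction l using List.reverseRecOn generalizing l' with
  | nil => exact (List.eq_nil_of_length_eq_zero h.symm).symm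
  | append_singleton l x ih =>
    rcases List.eq_nil_or_concat' l' with rfl | ⟨l', y, rfl⟩
    · simp at h
    · rw [code_append, code_append] at hc
      have hx := hl x (by simp)
      have hy := hl' y (by simp)
      have hq : code n l = code n l' := by
        have := congrArg (· / n) hc
        simpa [Nat.mul_add_div (by omega : 0 < n), Nat.div_eq_of_lt, hx, hy, mul_comm _ n]
          using this
      have hxy : x = y := by
        rw [hq] at hc
        omega
      rw [ih (by simpa using h) (fun z hz => hl z (by simp [hz])) (fun z hz => hl' z (by simp [hz]))
        hq, hxy]

/-! ### Formulas -/

/-- First-order formulas about the arrays, with bounded quantifiers. Variables are names of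
registers. A quantifier in a formula at level `b` binds register `b`, and its scope is at
level `b + 3`. -/
inductive Fm : Type
  | rel (a : ℕ) (vs : List ℕ)
  | eq (x y : ℕ)
  | not (φ : Fm)
  | and (φ ψ : Fm)
  | ex (φ : Fm)

namespace Fm

/-- The truth value of a formula at level `b`. -/
def Eval (a : ℕ → ℕ → ℕ) : Fm → ℕ → (ℕ → ℕ) → Prop
  | rel c vs, _, e => a c (code (e 0) (vs.map e)) ≠ 0
  | eq x y, _, e => e x = e y
  | not φ, b, e => ¬ φ.Eval a b e
  | and φ ψ, b, e => φ.Eval a b e ∧ ψ.Eval a b e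
  | ex φ, b, e => ∃ i < e 0, φ.Eval a (b + 3) (Function.update e b i)

/-- The free variables of a formula at level `b` belong to the list `A`. -/
def wellScoped : Fm → ℕ → List ℕ → Bool
  | rel _ vs, _, A => vs.all (A.contains ·)
  | eq x y, _, A => A.contains x && A.contains y
  | not φ, b, A => φ.wellScoped b A
  | and φ ψ, b, A => φ.wellScoped b A && ψ.wellScoped b A
  | ex φ, b, A => φ.wellScoped (b + 3) (b :: A)

/-- A program that evaluates a formula at level `b` and puts a nonzero number into register `b`
if and only if the formula holds. -/
def prog : Fm → ℕ → Prog
  | rel a vs, b => .seq (codeP 0 vs b) (.load b a b)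
  | eq x y, b => .seq (.sub b x y) <| .seq (.sub (b + 1) y x) <| .seq (.add b b (b + 1)) <|
      .cond b (.const b 0) (.const b 1)
  | not φ, b => .seq (φ.prog b) (.cond b (.const b 0) (.const b 1))
  | and φ ψ, b => .seq (φ.prog b) (.cond b (ψ.prog b) (.const b 0))
  | ex φ, b => .seq (.const (b + 2) 0) <| .seq
      (forP b (b + 3) (.seq (φ.prog (b + 3)) (.add (b + 2) (b + 2) (b + 3)))) (.copy b (b + 2))

/-- A bound for the running time of `prog`. -/
noncomputable def cost : Fm → Polynomial ℕ
  | rel _ vs => (vs.length : Polynomial ℕ) * (4 * Polynomial.X + 4) + 3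
  | eq _ _ => 5
  | not φ => φ.cost + 2
  | and φ ψ => φ.cost + ψ.cost + 2
  | ex φ => Polynomial.X * (φ.cost + 5) + 5

/-- Subformulas are evaluated after other code has overwritten registers from level `b` upwards;
scoping shows that this does not matter. -/
theorem eval_congr {a : ℕ → ℕ → ℕ} (φ : Fm) {b : ℕ} {A : List ℕ} {e e' : ℕ → ℕ}
    (hb : 0 < b) (hs : φ.wellScoped b A) (h0 : e' 0 = e 0) (h : ∀ r ∈ A, e' r = e r) :
    φ.Eval a b e' ↔ φ.Eval a b e := by
  induction φ generalizing b A e e' with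
  | rel c vs =>
    have : vs.map e' = vs.map e := List.map_congr_left fun x hx => h x (by
      simp only [wellScoped, List.all_eq_true, List.contains_iff_mem] at hs
      exact hs x hx)
    simp only [Eval, this, h0]
  | eq x y =>
    simp only [wellScoped, Bool.and_eq_true, List.contains_iff_mem] at hs
    simp only [Eval, h x hs.1, h y hs.2]
  | not φ ih => simp only [Eval, ih hb hs h0 h]
  | and φ ψ ih1 ih2 =>
    simp only [wellScoped, Bool.and_eq_true] at hs
    simp only [Eval, ih1 hb hs.1 h0 h, ih2 hb hs.2 h0 h]
  | ex φ ih =>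
    simp only [Eval, h0]
    refine exists_congr fun i => and_congr_right fun _ => ih (A := b :: A) (by omega) hs ?_ ?_
    · simp [Function.update_of_ne hb.ne, h0]
    · intro r hr
      by_cases hrb : r = b
      · simp [hrb]
      · simp only [Function.update_of_ne hrb]
        exact h r (by simpa [hrb] using hr)

/-- A quantifier keeps its variable in register `b`, the loop counter in `b + 1` and the sum of the
truth values in `b + 2`, so its scope starts at `b + 3`. The sum is nonzero exactly when some
instance holds. -/
theorem exec_prog (φ : Fm) {b : ℕ} {A : List ℕ} (hb : 0 < b) (hA : ∀ r ∈ A, r < b)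
    (hs : φ.wellScoped b A) (s : State) :
    Exec (φ.prog b) b (φ.cost.eval (s.reg 0)) s fun s' =>
      s'.arr = s.arr ∧ (s'.reg b ≠ 0 ↔ φ.Eval s.arr b s.reg) := by
  induction φ generalizing b A s with
  | rel c vs =>
    have hvs : ∀ v ∈ vs, v < b := fun v hv => by
      simp only [wellScoped, List.all_eq_true, List.contains_iff_mem] at hs
      exact hA v (hs v hv)
    refine Exec.mono (exec_seq ((exec_codeP hb vs hvs s).mono le_rfl le_rfl
      (Q' := fun s₂ => Exec _ _ 1 s₂ _) ?_)) le_rfl (by simp [cost]) fun _ _ h => h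
    rintro s₁ hf ⟨ha, hr⟩
    refine exec_load le_rfl ⟨ha, ?_⟩
    rw [setReg_reg, if_pos rfl, hr, ha]
    rfl
  | eq x y =>
    simp only [wellScoped, Bool.and_eq_true, List.contains_iff_mem] at hs
    have hx := hA x hs.1
    have hy := hA y hs.2
    refine Exec.mono (exec_seq (exec_sub le_rfl (exec_seq (exec_sub (by omega) (exec_seq
      (exec_add le_rfl (exec_cond (T := 1) ?_ ?_))))))) le_rfl (by simp [cost]) fun _ _ h => h
    · intro h
      refine exec_const le_rfl ⟨rfl, ?_⟩
      simp only [setReg_reg] at h ⊢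
      simp [hx.ne, hy.ne, Eval] at h ⊢
      omega
    · intro h
      refine exec_const le_rfl ⟨rfl, ?_⟩
      simp only [setReg_reg] at h ⊢
      simp [hx.ne, hy.ne, Eval] at h ⊢
      omega
  | not φ ih =>
    refine Exec.mono (exec_seq ((ih hb hA hs s).mono le_rfl le_rfl
      (Q' := fun s₂ => Exec _ _ 2 s₂ _) ?_)) le_rfl (by simp [cost]) fun _ _ h => h
    rintro s₁ hf ⟨ha, hr⟩
    refine exec_cond (T := 1) (fun h => exec_const le_rfl ⟨ha, ?_⟩)
      (fun h => exec_const le_rfl ⟨ha, ?_⟩)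
    · simpa [setReg_reg, Eval] using hr.1 h
    · simpa [setReg_reg, Eval] using fun h' => hr.2 h' h
  | and φ ψ ih1 ih2 =>
    simp only [wellScoped, Bool.and_eq_true] at hs
    refine Exec.mono (exec_seq ((ih1 hb hA hs.1 s).mono le_rfl le_rfl
      (Q' := fun s₂ => Exec _ _ (ψ.cost.eval (s.reg 0) + 1 + 1) s₂ _) ?_)) le_rfl
      (by simp [cost]; omega) fun _ _ h => h
    rintro s₁ hf ⟨ha, hr⟩
    refine exec_cond (fun h => ?_) (fun h => (exec_const le_rfl ⟨ha, ?_⟩).mono le_rfl (by omega)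
      fun _ _ h => h)
    · refine (ih2 hb hA hs.2 s₁).mono le_rfl (by rw [hf 0 hb]; omega) ?_
      rintro s₂ hf₂ ⟨ha₂, hr₂⟩
      refine ⟨ha₂.trans ha, ?_⟩
      rw [hr₂, ha, Eval, eval_congr ψ hb hs.2 (hf 0 hb) fun r hr => hf r (hA r hr)]
      simp [hr.1 h]
    · simp only [setReg_reg, Eval]
      simp [← hr, h]
  | ex φ ih =>
    have h0 : (s.setReg (b + 2) 0).reg 0 = s.reg 0 := by simp [setReg_reg]
    refine Exec.mono (exec_seq (exec_const (by omega) (exec_seq ((exec_for (c := b + 3)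
      (T := φ.cost.eval (s.reg 0) + 1)
      (Inv := fun i s' => s'.arr = s.arr ∧ (s'.reg (b + 2) ≠ 0 ↔
        ∃ j < i, φ.Eval s.arr (b + 3) (Function.update s.reg b j))) (by omega) ?_ ?_ ?_).mono
      le_rfl le_rfl (Q' := fun s₂ => Exec _ _ 1 s₂ _) ?_)))) le_rfl ?_ fun _ _ h => h
    · rintro i s₁ s₂ ha hr ⟨h1, h2⟩
      rw [ha, hr (b + 2) le_rfl (by omega)]
      exact ⟨h1, h2⟩
    · simp [setReg_reg]
    · rintro i hi s₁ hf hbi ⟨ha, hr⟩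
      have hf' : ∀ r < b, s₁.reg r = s.reg r := fun r hr => by
        rw [hf r hr, setReg_reg, if_neg (by omega)]
      refine exec_seq ((ih (b := b + 3) (A := b :: A) (by omega) ?_ hs s₁).mono (by omega)
        (by rw [hf' 0 hb]) ?_)
      · intro r hr
        rcases List.mem_cons.1 hr with rfl | hr
        · omega
        · have := hA r hr
          omega
      · rintro s₂ hf₂ ⟨ha₂, hr₂⟩
        refine exec_add le_rfl ⟨ha₂.trans ha, ?_⟩
        rw [ha, eval_congr φ (e := Function.update s.reg b i) (by omega) hs] at hr₂
        · rw [setReg_reg, if_pos rfl, hf₂ (b + 2) (by omega)]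
          have : s₁.reg (b + 2) + s₂.reg (b + 3) ≠ 0 ↔
              s₁.reg (b + 2) ≠ 0 ∨ s₂.reg (b + 3) ≠ 0 := by omega
          rw [this, hr, hr₂]
          constructor
          · rintro (⟨j, hj, h⟩ | h)
            · exact ⟨j, by omega, h⟩
            · exact ⟨i, by omega, h⟩
          · rintro ⟨j, hj, h⟩
            rcases Nat.lt_succ_iff_lt_or_eq.1 hj with hj | rfl
            · exact .inl ⟨j, hj, h⟩
            · exact .inr h
        · rw [Function.update_of_ne hb.ne, hf' 0 hb]
        · intro r hr
          by_cases hrb : r = b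
          · simp [hrb, hbi]
          · rw [Function.update_of_ne hrb]
            exact hf' r (hA r (by simpa [hrb] using hr))
    · rintro s₁ hf ⟨ha, hr⟩
      refine exec_copy le_rfl ⟨ha, ?_⟩
      rw [setReg_reg, if_pos rfl, hr, h0]
      rfl
    · rw [h0]
      simp only [cost, Polynomial.eval_add, Polynomial.eval_mul, Polynomial.eval_X]
      simp only [Polynomial.eval_ofNat]
      linarith

end Fm
end RAM

namespace RAM

/-! ### Commands -/

/-- Run `body` with the registers `b, b + 2, …` (`r` of them) going through all tuples of numbers
below the content of register `0`. -/
def nest : ℕ → ℕ → Prog → Prog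
  | 0, _, body => body
  | r + 1, b, body => forP b (b + 2) (nest r (b + 2) body)

/-- A bound for the running time of `nest`. -/
noncomputable def nestCost : ℕ → Polynomial ℕ → Polynomial ℕ
  | 0, p => p
  | r + 1, p => Polynomial.X * (nestCost r p + 4) + 3

/-- The registers `b, b + 2, …` contain the entries of the list. -/
def Regs {N : ℕ} : ℕ → List (Fin N) → (ℕ → ℕ) → Prop
  | _, [], _ => True
  | b, x :: t, e => e b = x ∧ Regs (b + 2) t e

/-- Indexing the invariant by the set of visited tuples hides the loop structure: a user only treats
the insertion of one tuple. -/
theorem exec_nest {N : ℕ} {p : Polynomial ℕ} {body : Prog} (r : ℕ) {b : ℕ} {s : State}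
    (hb : 0 < b) (h0 : s.reg 0 = N) {Inv : Set (List (Fin N)) → (ℕ → ℕ → ℕ) → Prop}
    (hI : Inv ∅ s.arr)
    (hbody : ∀ D t s₁, t.length = r → (∀ q < b, s₁.reg q = s.reg q) → Regs b t s₁.reg →
      Inv D s₁.arr →
      Exec body (b + 2 * r) (p.eval N) s₁ fun s' => Inv (insert t D) s'.arr) :
    Exec (nest r b body) b ((nestCost r p).eval N) s fun s' => Inv {t | t.length = r} s'.arr := by
  induction r generalizing b s Inv with
  | zero =>
    refine (hbody ∅ [] s rfl (fun _ _ => rfl) trivial hI).mono le_rfl le_rfl fun s' _ h => ?_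
    convert h using 1
    ext t
    simp
  | succ r ih =>
    refine (exec_for (T := (nestCost r p).eval N)
      (Inv := fun i s' => Inv {t | t.length = r + 1 ∧ ∃ x ∈ t.head?, x.1 < i} s'.arr) le_rfl
      (fun _ _ _ h _ => by simp only [h]; exact id) ?_ ?_).mono le_rfl ?_ ?_
    · simpa using hI
    · intro i hi s₁ hf hbi hI₁
      rw [h0] at hi
      -- The inner loops run with the invariant shifted: all tuples with head below `i` are done,
      -- and so are the tuples `i :: t` for the visited tails `t`.
      have := ih (b := b + 2) (s := s₁) (by omega) ((hf 0 hb).trans h0)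
        (Inv := fun D => Inv ({t | t.length = r + 1 ∧ ∃ x ∈ t.head?, x.1 < i} ∪
          List.cons ⟨i, hi⟩ '' D)) (by simpa using hI₁) ?_
      · refine this.mono le_rfl le_rfl fun s' _ h => ?_
        convert h using 1
        ext t
        cases t with
        | nil => simp
        | cons x t =>
          simp only [Set.mem_ofPred_eq, Set.mem_union, Set.mem_image, List.head?_cons,
            Option.mem_def, Option.some.injEq, exists_eq_left', List.cons.injEq, List.length_cons,
            Nat.add_right_cancel_iff]
          constructor
          · rintro ⟨h, h1⟩
            rcases Nat.lt_succ_iff_lt_or_eq.1 h1 with h1 | h1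
            · exact .inl ⟨h, h1⟩
            · exact .inr ⟨t, h, Fin.ext h1.symm, rfl⟩
          · rintro (⟨h, h1⟩ | ⟨t', h, h1, rfl⟩)
            · exact ⟨h, by omega⟩
            · exact ⟨h, by rw [← h1]; exact Nat.lt_succ_self i⟩
      · intro D t s₂ ht hf₂ hr hD
        refine (hbody _ (⟨i, hi⟩ :: t) s₂ (by simp [ht])
          (fun q hq => (hf₂ q (by omega)).trans (hf q hq))
          ⟨(hf₂ b (by omega)).trans hbi, hr⟩ hD).mono (by omega) le_rfl fun s' _ h => ?_
        rwa [Set.image_insert_eq, Set.union_insert]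
    · simp [nestCost, h0]
    · intro s' _ h
      convert h using 1
      ext t
      cases t with
      | nil => simp
      | cons x t => simp [h0]

/-- Run `P` if the formula `φ` holds. -/
def ifP (φ : Fm) (b : ℕ) (P : Prog) : Prog :=
  .seq (φ.prog b) (.cond b P (.const b 0))

theorem exec_if {φ : Fm} {b T : ℕ} {A : List ℕ} {P : Prog} {s : State} {Q : State → Prop}
    (hb : 0 < b) (hA : ∀ r ∈ A, r < b) (hs : φ.wellScoped b A)
    (h1 : φ.Eval s.arr b s.reg → ∀ s₁, s₁.arr = s.arr → (∀ r < b, s₁.reg r = s.reg r) →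
      Exec P b T s₁ Q)
    (h2 : ¬ φ.Eval s.arr b s.reg → ∀ s₁, s₁.arr = s.arr → (∀ r < b, s₁.reg r = s.reg r) → Q s₁) :
    Exec (ifP φ b P) b (φ.cost.eval (s.reg 0) + T + 2) s Q := by
  refine Exec.mono (exec_seq ((φ.exec_prog hb hA hs s).mono le_rfl le_rfl
    (Q' := fun s₂ => Exec _ _ (T + 1 + 1) s₂ _) ?_)) le_rfl (by omega) fun _ _ h => h
  rintro s₁ hf ⟨ha, hr⟩
  refine exec_cond (fun h => (h1 (hr.1 h) s₁ ha hf).mono le_rfl (by omega) fun _ _ h => h)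
    (fun h => (exec_const le_rfl (h2 (fun h' => hr.2 h' h) _ ha ?_)).mono le_rfl (by omega)
      fun _ _ h => h)
  intro r hr
  rw [setReg_reg, if_neg hr.ne, hf r hr]

/-- The arrays `a` with the entry `v` in cell `j` of array `c`. -/
def put (a : ℕ → ℕ → ℕ) (c j v : ℕ) : ℕ → ℕ → ℕ :=
  fun c' j' => if c' = c ∧ j' = j then v else a c' j'

/-- Write the constant `v` into the cell of array `c` whose index is the code, in base the content
of register `base`, of the contents of the registers `vs`. -/
def setP (base c : ℕ) (vs : List ℕ) (v b : ℕ) : Prog :=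
  .seq (codeP base vs b) <| .seq (.const (b + 1) v) (.store c b (b + 1))

theorem exec_setP {base c v b : ℕ} {vs : List ℕ} {s : State} {Q : State → Prop} (h1 : base < b)
    (h2 : ∀ v ∈ vs, v < b)
    (h : ∀ s₁, s₁.arr = put s.arr c (code (s.reg base) (vs.map s.reg)) v →
      (∀ r < b, s₁.reg r = s.reg r) → Q s₁) :
    Exec (setP base c vs v b) b (vs.length * (4 * s.reg base + 4) + 4) s Q := by
  refine Exec.mono (exec_seq ((exec_codeP h1 vs h2 s).mono le_rfl le_rfl
    (Q' := fun s₂ => Exec _ _ 2 s₂ _) ?_)) le_rfl (by omega) fun _ _ h => h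
  rintro s₁ hf ⟨ha, hr⟩
  refine exec_seq (exec_const (by omega) (exec_store (h _ ?_ ?_)))
  · funext c' j
    simp [setArr_arr, put, setReg_reg, hr, ha]
  · intro r hr
    rw [setArr_reg, setReg_reg, if_neg (by omega), hf r hr]

end RAM

/-! ### Labels of the edges of a token graph -/

/-- The only way in which the two forbidden subgraphs are used: with `u` and `v`, two common
neighbours induce a diamond if they are adjacent and a four-cycle otherwise. -/
theorem IsC4DiamondFree.eq_of_common_neighbors {V : Type*} {G : SimpleGraph V}
    (hG : IsC4DiamondFree G) {u v p q : V} (huv : u ≠ v) (h : ¬ G.Adj u v) (hup : G.Adj u p)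
    (hvp : G.Adj v p) (huq : G.Adj u q) (hvq : G.Adj v q) : p = q := by
  by_contra hpq
  have h₂ : ¬ G.Adj v u := fun h' => h h'.symm
  by_cases h' : G.Adj p q
  · refine hG.2 ⟨⟨⟨![u, v, p, q], ?_⟩, fun {i j} => ?_⟩⟩
    · intro i j
      fin_cases i <;> fin_cases j <;>
        simp [huv, huv.symm, hup.ne, hup.ne', hvp.ne, hvp.ne', huq.ne, huq.ne', hvq.ne, hvq.ne',
          hpq, Ne.symm hpq]
    · change G.Adj (![u, v, p, q] i) (![u, v, p, q] j) ↔ _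
      fin_cases i <;> fin_cases j <;>
        simp [diamondGraph, h, h₂, hup, hup.symm, hvp, hvp.symm, huq, huq.symm, hvq,
          hvq.symm, h', h'.symm]
  · have h'₂ : ¬ G.Adj q p := fun h => h' h.symm
    refine hG.1 ⟨⟨⟨![u, p, v, q], ?_⟩, fun {i j} => ?_⟩⟩
    · intro i j
      fin_cases i <;> fin_cases j <;>
        simp [huv, huv.symm, hup.ne, hup.ne', hvp.ne, hvp.ne', huq.ne, huq.ne', hvq.ne, hvq.ne',
          hpq, Ne.symm hpq]
    · change G.Adj (![u, p, v, q] i) (![u, p, v, q] j) ↔ _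
      fin_cases i <;> fin_cases j <;>
        simp [SimpleGraph.cycleGraph_adj, h, h₂, hup, hup.symm, hvp, hvp.symm, huq,
          huq.symm, hvq, hvq.symm, h', h'₂] <;> decide

/-! ### Sliding tokens in a connected graph -/

/-- One token of a set of tokens moves along an edge. -/
def TokenStep {U : Type*} [DecidableEq U] (D : SimpleGraph U) (A B : Finset U) : Prop :=
  ∃ p q, D.Adj p q ∧ p ∈ A ∧ q ∉ A ∧ B = insert q (A.erase p)

theorem Finset.insert_erase_insert_erase {U : Type*} [DecidableEq U] {S : Finset U} {p q r : U}
    (hr : r ∈ S) (hq : q ∉ S) (hp : p ∈ S) (hpr : p ≠ r) :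
    insert q (S.erase p) = insert r ((insert q (S.erase r)).erase p) := by
  ext v
  simp only [Finset.mem_insert, Finset.mem_erase]
  grind

theorem Finset.insert_erase_insert {U : Type*} [DecidableEq U] {S : Finset U} {q r : U}
    (hr : r ∉ S) : insert q S = insert q ((insert r S).erase r) := by
  rw [Finset.erase_insert hr]

/-- In a connected graph, tokens can be moved along edges from any place to any other. -/
theorem reflTransGen_tokenStep {U : Type*} [DecidableEq U] {D : SimpleGraph U}
    (hD : D.Preconnected) {S T : Finset U} (h : S.card = T.card) :
    Relation.ReflTransGen (TokenStep D) S T := by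
  -- Tokens are indistinguishable, so occupied vertices on a walk are no obstacle: if the next
  -- vertex `r` is occupied, its token first goes on to `q`, and then the token at `p` steps to `r`.
  have swap : ∀ {p q : U}, D.Walk p q → ∀ S : Finset U, p ∈ S → q ∉ S →
      Relation.ReflTransGen (TokenStep D) S (insert q (S.erase p)) := by
    intro p q w
    induction w with
    | nil => exact fun S h h' => absurd h h'
    | @cons p r q hpr w ih =>
      intro S hp hq
      by_cases hr : r ∈ S
      · refine (ih S hr hq).tail ⟨p, r, hpr, ?_, ?_, ?_⟩
        · simp [hpr.ne, hp]
        · simp only [Finset.mem_insert, Finset.mem_erase]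
          rintro (rfl | h)
          · exact hq hr
          · exact h.1 rfl
        · exact Finset.insert_erase_insert_erase hr hq hp hpr.ne
      · by_cases hrq : r = q
        · subst hrq
          exact .single ⟨p, r, hpr, hp, hr, rfl⟩
        · refine .head ⟨p, r, hpr, hp, hr, rfl⟩ ?_
          convert ih (insert r (S.erase p)) (by simp) ?_ using 1
          · exact Finset.insert_erase_insert (by simp [hr])
          · simp [hq, Ne.symm hrq]
  -- Each swap reduces the number of misplaced tokens by one.
  induction hd : (S \ T).card generalizing S with
  | zero =>
    rw [Finset.card_eq_zero, Finset.sdiff_eq_empty_iff_subset] at hd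
    rw [Finset.eq_of_subset_of_card_le hd h.ge]
  | succ d ih =>
    obtain ⟨p, hp⟩ : (S \ T).Nonempty := Finset.card_pos.1 (by omega)
    obtain ⟨q, hq⟩ : (T \ S).Nonempty := by
      have := Finset.card_sdiff_add_card_inter S T
      have := Finset.card_sdiff_add_card_inter T S
      rw [Finset.inter_comm] at this
      exact Finset.card_pos.1 (by omega)
    simp only [Finset.mem_sdiff] at hp hq
    obtain ⟨w⟩ := hD p q
    refine (swap w S hp.1 hq.2).trans (ih ?_ ?_)
    · rw [Finset.card_insert_of_notMem (by simp [hq.2]), Finset.card_erase_add_one hp.1, h]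
    · have : insert q (S.erase p) \ T = (S \ T).erase p := by
        rw [Finset.insert_sdiff_of_mem _ hq.1, Finset.erase_sdiff_comm]
      rw [this, Finset.card_erase_of_mem (by simp [hp]), hd]
      rfl

/-! ### Relations that refer to the token graph alone -/

section Definitions

variable {W : Type*} (Γ : SimpleGraph W)

/-- `(x, y)` and `(u, v)` are opposite edges of an induced cycle on four vertices. -/
def OppositeEdges (x y u v : W) : Prop :=
  Γ.Adj x y ∧ Γ.Adj y v ∧ Γ.Adj u v ∧ Γ.Adj x u ∧ x ≠ v ∧ ¬ Γ.Adj x v ∧ y ≠ u ∧ ¬ Γ.Adj y u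

/-- The relation that generates the equality of labels. -/
def LabelStep (p q : W × W) : Prop :=
  OppositeEdges Γ p.1 p.2 q.1 q.2 ∨ Γ.Adj p.1 p.2 ∧ q.1 = p.2 ∧ q.2 = p.1

/-- The edges `p` and `q` are joined by a chain of generating steps. -/
def SameLabel (p q : W × W) : Prop :=
  Relation.ReflTransGen (LabelStep Γ) p q

/-- A path on three vertices whose edges are not consecutive edges of an induced cycle on four
vertices. -/
def Wedge (x y z : W) : Prop :=
  Γ.Adj x y ∧ Γ.Adj y z ∧ x ≠ z ∧ ¬ ∃ w, OppositeEdges Γ x y w z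

/-- The labels of two edges have exactly one vertex in common. -/
def Meet (x y u v : W) : Prop :=
  ∃ a b c, Wedge Γ a b c ∧ SameLabel Γ (a, b) (x, y) ∧ SameLabel Γ (b, c) (u, v)

/-- The labels of three edges form a triangle. -/
def Triangular (x y z u v : W) : Prop :=
  ∃ a b c, (Γ.Adj a b ∧ Γ.Adj b c ∧ Γ.Adj a c) ∧ SameLabel Γ (a, b) (x, y) ∧
    SameLabel Γ (b, c) (y, z) ∧ SameLabel Γ (a, c) (u, v)

/-- The common vertex of the labels of a wedge is in the label of an edge. -/
def Inc (x y z u v : W) : Prop :=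
  Γ.Adj u v ∧ (SameLabel Γ (x, y) (u, v) ∨ SameLabel Γ (y, z) (u, v) ∨
    Meet Γ x y u v ∧ Meet Γ y z u v ∧ ¬ Triangular Γ x y z u v)

/-- Two wedges determine the same vertex. -/
def SameVertex (x y z x' y' z' : W) : Prop :=
  Inc Γ x y z x' y' ∧ Inc Γ x y z y' z'

/-- Two wedges determine adjacent vertices. -/
def AdjVertex (x y z x' y' z' : W) : Prop :=
  ¬ SameVertex Γ x y z x' y' z' ∧ ∃ u v, Inc Γ x y z u v ∧ Inc Γ x' y' z' u v

end Definitions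

/-! ### Labels around an induced four-cycle -/

section Label

variable {V W : Type*} [DecidableEq V] {G : SimpleGraph V} {Γ : SimpleGraph W} {k : ℕ}
  (τ : Γ ≃g tokenGraph G k)

/-- The label of a pair of vertices. -/
def lab (x y : W) : Finset V :=
  symmDiff (τ x).1 (τ y).1

theorem adj_iff_lab {x y : W} : Γ.Adj x y ↔ ∃ a b, G.Adj a b ∧ lab τ x y = {a, b} :=
  (τ.map_adj_iff).symm

theorem lab_comm (x y : W) : lab τ x y = lab τ y x := symmDiff_comm _ _

theorem lab_trans (x y z : W) : symmDiff (lab τ x y) (lab τ y z) = lab τ x z := by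
  simp only [lab]
  rw [symmDiff_assoc, symmDiff_symmDiff_cancel_left]

theorem mem_lab {x y : W} {v : V} : v ∈ lab τ x y ↔ ¬ (v ∈ (τ x).1 ↔ v ∈ (τ y).1) := by
  rw [lab, Finset.mem_symmDiff]
  tauto

theorem lab_eq_empty {x y : W} : lab τ x y = ∅ ↔ x = y := by
  rw [lab, ← Finset.bot_eq_empty, symmDiff_eq_bot]
  exact ⟨fun h => τ.injective (Subtype.ext h), fun h => by rw [h]⟩

theorem lab_left_inj {x y z : W} (h : lab τ x y = lab τ x z) : y = z := by
  rw [← lab_eq_empty τ, ← lab_trans τ y x z, lab_comm τ y x, h, symmDiff_self]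
  rfl

/-- Both sets have `k` elements: if `a` and `b` were on the same side, one set would contain the
other and the two would coincide. -/
theorem mem_iff_notMem_of_lab {x y : W} {a b : V} (h : lab τ x y = {a, b}) :
    a ∈ (τ x).1 ↔ b ∉ (τ x).1 := by
  have hm := fun v => (mem_lab τ (x := x) (y := y) (v := v)).symm
  simp only [h, Finset.mem_insert, Finset.mem_singleton] at hm
  have hne : x ≠ y := fun h' => by
    have := (lab_eq_empty τ).2 h'
    rw [h] at this
    simp at this
  by_contra hc
  apply hne
  apply τ.injective
  apply Subtype.ext
  have hcard := (τ x).2.trans (τ y).2.symm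
  by_cases ha : a ∈ (τ x).1
  · refine (Finset.eq_of_subset_of_card_le (fun v hv => ?_) hcard.le).symm
    have := hm v
    by_contra hvx
    have : v = a ∨ v = b := by tauto
    rcases this with rfl | rfl <;> tauto
  · refine Finset.eq_of_subset_of_card_le (fun v hv => ?_) hcard.ge
    have := hm v
    by_contra hvx
    have : v = a ∨ v = b := by tauto
    rcases this with rfl | rfl <;> tauto

theorem exists_eq_of_card {A : Finset V} (h : A.card = k) : ∃ x, (τ x).1 = A :=
  ⟨τ.symm ⟨A, h⟩, by simp⟩

theorem lab_insert {x y : W} {S : Finset V} {a b : V} (hab : a ≠ b) (ha : a ∉ S) (hb : b ∉ S)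
    (hx : (τ x).1 = insert a S) (hy : (τ y).1 = insert b S) : lab τ x y = {a, b} := by
  ext v
  rw [mem_lab, hx, hy]
  simp only [Finset.mem_insert, Finset.mem_singleton]
  grind

theorem OppositeEdges.symm {x y u v : W} (h : OppositeEdges Γ x y u v) : OppositeEdges Γ u v x y :=
  ⟨h.2.2.1, h.2.1.symm, h.1, h.2.2.2.1.symm, h.2.2.2.2.2.2.1.symm,
    fun h' => h.2.2.2.2.2.2.2 h'.symm, h.2.2.2.2.1.symm, fun h' => h.2.2.2.2.2.1 h'.symm⟩

theorem exists_of_mem_lab {x y : W} {b : V} (h : Γ.Adj x y) (hb : b ∈ lab τ x y) :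
    ∃ a, G.Adj b a ∧ lab τ x y = {b, a} := by
  obtain ⟨p, q, hpq, hl⟩ := (adj_iff_lab τ).1 h
  rw [hl, Finset.mem_insert, Finset.mem_singleton] at hb
  rcases hb with rfl | rfl
  · exact ⟨q, hpq, hl⟩
  · exact ⟨p, hpq.symm, by rw [hl, Finset.pair_comm]⟩

theorem card_lab {x y : W} (h : Γ.Adj x y) : (lab τ x y).card = 2 := by
  obtain ⟨p, q, hpq, hl⟩ := (adj_iff_lab τ).1 h
  rw [hl, Finset.card_pair hpq.ne]

theorem adj_of_lab {x y : W} {a b : V} (h : Γ.Adj x y) (hl : lab τ x y = {a, b}) : G.Adj a b := by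
  obtain ⟨c, hc, hl'⟩ := exists_of_mem_lab τ (b := a) h (by simp [hl])
  have hb : b ∈ ({a, c} : Finset V) := by rw [← hl', hl]; simp
  have hca : c ∈ ({a, b} : Finset V) := by rw [← hl, hl']; simp
  have := hc.ne
  simp only [Finset.mem_insert, Finset.mem_singleton] at hb hca
  grind

theorem mem_lab_trans {x y z : W} {v : V} :
    v ∈ lab τ x z ↔ ¬ (v ∈ lab τ x y ↔ v ∈ lab τ y z) := by
  rw [← lab_trans τ x y z, Finset.mem_symmDiff]
  tauto

/-- If the labels were `{b, a}` and `{b, c}`, then `a` and `c` would be nonadjacent, because `x` and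
`v` are. The way from `x` to `v` through `u` must again use a common neighbour of `a` and `c`, hence
`b`, which leaves no room for `u ≠ y`. -/
theorem OppositeEdges.disjoint_lab (hG : IsC4DiamondFree G) {x y u v : W}
    (h : OppositeEdges Γ x y u v) : Disjoint (lab τ x y) (lab τ y v) := by
  obtain ⟨hxy, hyv, huv, hxu, hxv, hxv', hyu, hyu'⟩ := h
  rw [Finset.disjoint_left]
  intro b hb hb'
  obtain ⟨a, ha, hab⟩ := exists_of_mem_lab τ hxy hb
  obtain ⟨c, hc, hbc⟩ := exists_of_mem_lab τ hyv hb'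
  have hac : a ≠ c := by
    rintro rfl
    apply hxv
    rw [← lab_eq_empty τ, ← lab_trans τ x y v, hab, hbc, symmDiff_self]
    rfl
  have hl : lab τ x v = {a, c} := by
    ext w
    rw [mem_lab_trans τ (y := y), hab, hbc]
    have := ha.ne
    have := hc.ne
    simp only [Finset.mem_insert, Finset.mem_singleton]
    grind
  have hac' : ¬ G.Adj a c := fun h => hxv' ((adj_iff_lab τ).2 ⟨a, c, h, hl⟩)
  have hm := fun w => mem_lab_trans τ (x := x) (y := u) (z := v) (v := w)
  simp only [hl, Finset.mem_insert, Finset.mem_singleton] at hm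
  -- The labels of `xu` and `uv` have symmetric difference `{a, c}`, so they are `{a, e}` and `{c,
  -- e}` in some order.
  have key : ∃ e, G.Adj a e ∧ G.Adj c e ∧ (lab τ x u = {a, e} ∨ lab τ x u = {c, e}) := by
    by_cases h1 : a ∈ lab τ x u
    · obtain ⟨e, he, hle⟩ := exists_of_mem_lab τ hxu h1
      have h2 : c ∉ lab τ x u := fun h => by
        simp only [hle, Finset.mem_insert, Finset.mem_singleton] at h
        rcases h with h | rfl
        · exact hac h.symm
        · exact hac' he
      have h3 : c ∈ lab τ u v := by
        have := hm c
        tauto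
      obtain ⟨f, hf, hlf⟩ := exists_of_mem_lab τ huv h3
      have h4 := hm e
      rw [hle] at h4 h2
      rw [hlf] at h4
      simp only [Finset.mem_insert, Finset.mem_singleton] at h4 h2
      have := he.ne
      have : e = f := by grind
      exact ⟨e, he, this ▸ hf, .inl hle⟩
    · have h2 : a ∈ lab τ u v := by
        have := hm a
        tauto
      obtain ⟨e, he, hle⟩ := exists_of_mem_lab τ huv h2
      have h3 : c ∉ lab τ u v := fun h => by
        simp only [hle, Finset.mem_insert, Finset.mem_singleton] at h
        rcases h with h | rfl
        · exact hac h.symm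
        · exact hac' he
      have h4 : c ∈ lab τ x u := by
        have := hm c
        tauto
      obtain ⟨f, hf, hlf⟩ := exists_of_mem_lab τ hxu h4
      have h5 := hm e
      rw [hle] at h5 h3
      rw [hlf] at h5
      simp only [Finset.mem_insert, Finset.mem_singleton] at h5 h3
      have := he.ne
      have : e = f := by grind
      exact ⟨e, he, this ▸ hf, .inr (this ▸ hlf)⟩
  obtain ⟨e, hae, hce, he⟩ := key
  obtain rfl : b = e := hG.eq_of_common_neighbors hac hac' ha.symm hc.symm hae hce
  -- The first case gives `u = y`. In the second, the set at `x` would separate each two of `a`,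
  -- `b`, `c`, which is impossible.
  rcases he with he | he
  · exact hyu (lab_left_inj τ (hab.trans (by rw [he, Finset.pair_comm])))
  · have h1 := mem_iff_notMem_of_lab τ hab
    have h2 := mem_iff_notMem_of_lab τ hl
    have h3 := mem_iff_notMem_of_lab τ he
    tauto

/-- The labels around the cycle have symmetric difference `∅`. So if the label of `xy` misses both
neighbouring labels, it lies in the label of `uv`, and both have two elements. -/
theorem OppositeEdges.lab_eq (hG : IsC4DiamondFree G) {x y u v : W}
    (h : OppositeEdges Γ x y u v) : lab τ x y = lab τ u v := by
  have hd := Finset.disjoint_left.1 (h.disjoint_lab τ hG)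
  obtain ⟨hxy, hyv, huv, hxu, hxv, hxv', hyu, hyu'⟩ := h
  by_cases hb : ∃ b, b ∈ lab τ x y ∧ b ∈ lab τ x u
  · exfalso
    obtain ⟨b, hb, hb'⟩ := hb
    obtain ⟨a, hba, hla⟩ := exists_of_mem_lab τ hxy hb
    obtain ⟨d, hbd, hld⟩ := exists_of_mem_lab τ hxu hb'
    have had : a ≠ d := fun h => hyu (lab_left_inj τ (by rw [hla, hld, h]))
    have hxv₁ := fun w => mem_lab_trans τ (x := x) (y := y) (z := v) (v := w)
    have hxv₂ := fun w => mem_lab_trans τ (x := x) (y := u) (z := v) (v := w)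
    have haT : a ∈ lab τ u v := by
      have h1 := hxv₁ a
      have h2 := hxv₂ a
      have h3 : a ∈ lab τ x y := by simp [hla]
      have h4 : a ∉ lab τ x u := by simp [hld, hba.ne', had]
      have := @hd a
      tauto
    obtain ⟨f, haf, hlf⟩ := exists_of_mem_lab τ huv haT
    obtain ⟨p, q, hpq, hl⟩ := (adj_iff_lab τ).1 hyv
    have hmem : ∀ w, w ∈ lab τ y v → w = d ∨ w = f := by
      intro w hw
      have h1 := hxv₁ w
      have h2 := hxv₂ w
      have h3 : w ∉ lab τ x y := fun h => hd h hw
      have h4 : w ∈ lab τ x u ∨ w ∈ lab τ u v := by tauto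
      rw [hla] at h3
      rw [hld, hlf] at h4
      simp only [Finset.mem_insert, Finset.mem_singleton] at h3 h4
      tauto
    have hp := hmem p (by simp [hl])
    have hq := hmem q (by simp [hl])
    have hdf : G.Adj d f ∧ f ∈ lab τ y v := by
      rw [hl]
      rcases hp with rfl | rfl <;> rcases hq with rfl | rfl
      · exact absurd rfl hpq.ne
      · exact ⟨hpq, by simp⟩
      · exact ⟨hpq.symm, by simp⟩
      · exact absurd rfl hpq.ne
    have hyu₁ : lab τ y u = {a, d} := by
      ext w
      rw [mem_lab_trans τ (y := x), lab_comm τ y x, hla, hld]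
      have := hba.ne
      have := hbd.ne
      simp only [Finset.mem_insert, Finset.mem_singleton]
      grind
    have hnad : ¬ G.Adj a d := fun h => hyu' ((adj_iff_lab τ).2 ⟨a, d, h, hyu₁⟩)
    obtain rfl := hG.eq_of_common_neighbors had hnad hba.symm hbd.symm haf hdf.1
    exact hd hb hdf.2
  · push Not at hb
    refine Finset.eq_of_subset_of_card_le (fun w hw => ?_) (by rw [card_lab τ hxy, card_lab τ huv])
    have h1 := mem_lab_trans τ (x := x) (y := y) (z := v) (v := w)
    have h2 := mem_lab_trans τ (x := x) (y := u) (z := v) (v := w)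
    have h3 := hd hw
    have h4 := hb w hw
    tauto

end Label

/-! ### Equality of labels and wedges, seen in the token graph -/

section Label

variable {V W : Type*} [DecidableEq V] {G : SimpleGraph V} {Γ : SimpleGraph W} {k : ℕ}
  (τ : Γ ≃g tokenGraph G k)

/-- The other two sides have equal labels as well, so both diagonals have symmetric differences of
size four and are not edges. -/
theorem oppositeEdges_of_lab_eq {x y u v : W} (hxy : Γ.Adj x y) (hyv : Γ.Adj y v)
    (hd : Disjoint (lab τ x y) (lab τ y v)) (h : lab τ x y = lab τ u v) :
    OppositeEdges Γ x y u v := by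
  have h₁ : lab τ x u = lab τ y v := by
    rw [← lab_trans τ x v u, ← lab_trans τ x y v, lab_comm τ v u, ← h,
      symmDiff_comm (lab τ x y), symmDiff_symmDiff_cancel_right]
  have hxv : (lab τ x v).card = 4 := by
    rw [← lab_trans τ x y v, hd.symmDiff_eq_sup, Finset.sup_eq_union,
      Finset.card_union_of_disjoint hd, card_lab τ hxy, card_lab τ hyv]
  have hyu : (lab τ y u).card = 4 := by
    rw [← lab_trans τ y x u, lab_comm τ y x, h₁, hd.symmDiff_eq_sup, Finset.sup_eq_union,
      Finset.card_union_of_disjoint hd, card_lab τ hxy, card_lab τ hyv]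
  have aux : ∀ {p q : W}, (lab τ p q).card = 4 → p ≠ q ∧ ¬ Γ.Adj p q := by
    refine fun {p q} h => ⟨fun h' => ?_, fun h' => ?_⟩
    · rw [(lab_eq_empty τ).2 h'] at h
      simp at h
    · rw [card_lab τ h'] at h
      omega
  refine ⟨hxy, hyv, ?_, ?_, (aux hxv).1, (aux hxv).2, (aux hyu).1, (aux hyu).2⟩
  · obtain ⟨a, b, hab, hl⟩ := (adj_iff_lab τ).1 hxy
    exact (adj_iff_lab τ).2 ⟨a, b, hab, h ▸ hl⟩
  · obtain ⟨a, b, hab, hl⟩ := (adj_iff_lab τ).1 hyv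
    exact (adj_iff_lab τ).2 ⟨a, b, hab, h₁ ▸ hl⟩

theorem SameLabel.lab_eq (hG : IsC4DiamondFree G) {p q : W × W} (h : SameLabel Γ p q) :
    lab τ p.1 p.2 = lab τ q.1 q.2 := by
  induction h with
  | refl => rfl
  | tail _ h ih =>
    rw [ih]
    rcases h with h | ⟨-, h₁, h₂⟩
    · exact h.lab_eq τ hG
    · rw [h₁, h₂, lab_comm]

/-- While one token sits on `a` or `c`, a step of another token along an edge `pq` avoiding both
spans a square with labels `{a, c}` and `{p, q}`. -/
theorem sameLabel_of_reflTransGen {a c : V} (hac : G.Adj a c)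
    {S T : Finset {v : V | v ∉ ({a, c} : Finset V)}}
    (h : Relation.ReflTransGen (TokenStep (G.induce {v : V | v ∉ ({a, c} : Finset V)})) S T)
    {x y u v : W} (hx : (τ x).1 = insert a (S.map (Function.Embedding.subtype _)))
    (hy : (τ y).1 = insert c (S.map (Function.Embedding.subtype _)))
    (hu : (τ u).1 = insert a (T.map (Function.Embedding.subtype _)))
    (hv : (τ v).1 = insert c (T.map (Function.Embedding.subtype _))) :
    SameLabel Γ (x, y) (u, v) := by
  have hmem : ∀ A : Finset {v : V | v ∉ ({a, c} : Finset V)},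
      a ∉ A.map (Function.Embedding.subtype _) ∧ c ∉ A.map (Function.Embedding.subtype _) := by
    intro A
    constructor <;> simp
  induction h generalizing u v with
  | refl =>
    rw [τ.injective (Subtype.ext (hx.trans hu.symm)), τ.injective (Subtype.ext (hy.trans hv.symm))]
    exact .refl
  | @tail B C _ hBC ih =>
    obtain ⟨p, q, hpq, hp, hq, rfl⟩ := hBC
    have hcard : (insert q (B.erase p)).card = B.card := by
      rw [Finset.card_insert_of_notMem (by simp [hq]), Finset.card_erase_add_one hp]
    have hk : B.card + 1 = k := by
      rw [← (τ u).2, hu, Finset.card_insert_of_notMem (hmem _).1, Finset.card_map, hcard]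
    obtain ⟨u', hu'⟩ := exists_eq_of_card τ
      (A := insert a (B.map (Function.Embedding.subtype _)))
      (by rw [Finset.card_insert_of_notMem (hmem _).1, Finset.card_map, hk])
    obtain ⟨v', hv'⟩ := exists_eq_of_card τ
      (A := insert c (B.map (Function.Embedding.subtype _)))
      (by rw [Finset.card_insert_of_notMem (hmem _).2, Finset.card_map, hk])
    refine (ih hu' hv').tail (.inl ?_)
    have hl₁ := lab_insert τ hac.ne (hmem B).1 (hmem B).2 hu' hv'
    have hl₂ := lab_insert τ hac.ne (hmem _).1 (hmem _).2 hu hv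
    have hp' := p.2
    have hq' := q.2
    simp only [Set.mem_ofPred_eq, Finset.mem_insert, Finset.mem_singleton, not_or] at hp' hq'
    have hl₃ : lab τ v' v = {p.1, q.1} := by
      have hne : p.1 ≠ q.1 := fun h => hpq.ne (Subtype.ext h)
      refine lab_insert τ (S := insert c ((B.erase p).map (Function.Embedding.subtype _))) hne
        ?_ ?_ ?_ ?_
      · simp [hp'.2]
      · simp [hq'.2, hq]
      · rw [hv', Finset.insert_comm, ← Finset.insert_erase hp, Finset.map_insert]
        simp
      · rw [hv, Finset.insert_comm, Finset.map_insert]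
        rfl
    refine oppositeEdges_of_lab_eq τ ((adj_iff_lab τ).2 ⟨a, c, hac, hl₁⟩)
      ((adj_iff_lab τ).2 ⟨p, q, hpq, hl₃⟩) ?_ (hl₁.trans hl₂.symm)
    rw [hl₁, hl₃]
    simp [hp', hq']

theorem exists_insert_of_lab {x y : W} {a c : V} (hl : lab τ x y = {a, c}) (hac : a ≠ c)
    (hx : a ∈ (τ x).1) : ∃ S : Finset {v : V | v ∉ ({a, c} : Finset V)}, S.card + 1 = k ∧
      (τ x).1 = insert a (S.map (Function.Embedding.subtype _)) ∧
      (τ y).1 = insert c (S.map (Function.Embedding.subtype _)) := by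
  have hc := (mem_iff_notMem_of_lab τ hl).1 hx
  have hx' : (τ x).1 = insert a (((τ x).1.subtype (· ∈ {v : V | v ∉ ({a, c} : Finset V)})).map
      (Function.Embedding.subtype _)) := by
    ext v
    by_cases hva : v = a
    · simp [hva, hx]
    · have : v ∈ (τ x).1 → v ≠ c := fun h h' => hc (h' ▸ h)
      simp [hva]
      tauto
  refine ⟨(τ x).1.subtype _, ?_, hx', ?_⟩
  · have := (τ x).2
    rwa [hx', Finset.card_insert_of_notMem (by simp), Finset.card_map] at this
  · ext v
    have := mem_lab τ (x := x) (y := y) (v := v)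
    rw [hl] at this
    simp only [Finset.mem_insert, Finset.mem_singleton] at this
    by_cases hva : v = a
    · subst hva
      simp [hac]
      tauto
    · by_cases hvc : v = c
      · subst hvc
        simp
        tauto
      · simp [hva, hvc]
        tauto

/-- `hcon` is what 3-connectivity provides: the other `k - 1` tokens can be rearranged at will away
from `a` and `c`. Squares preserve which endpoint of the edge has its token on `a`, so the reversal
step is needed to compare the two orientations. -/
theorem sameLabel_iff (hG : IsC4DiamondFree G)
    (hcon : ∀ a c : V, (G.induce {v : V | v ∉ ({a, c} : Finset V)}).Preconnected)
    {x y u v : W} (hxy : Γ.Adj x y) :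
    SameLabel Γ (x, y) (u, v) ↔ lab τ x y = lab τ u v := by
  refine ⟨fun h => h.lab_eq τ hG, fun h => ?_⟩
  obtain ⟨a, c, hac, hl⟩ := (adj_iff_lab τ).1 hxy
  have huv : Γ.Adj u v := (adj_iff_lab τ).2 ⟨a, c, hac, h ▸ hl⟩
  rw [hl] at h
  have key : ∀ {x y u v : W}, lab τ x y = {a, c} → lab τ u v = {a, c} → a ∈ (τ x).1 →
      a ∈ (τ u).1 → SameLabel Γ (x, y) (u, v) := by
    intro x y u v h₁ h₂ hx hu
    obtain ⟨S, hS, hSx, hSy⟩ := exists_insert_of_lab τ h₁ hac.ne hx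
    obtain ⟨T, hT, hTu, hTv⟩ := exists_insert_of_lab τ h₂ hac.ne hu
    exact sameLabel_of_reflTransGen τ hac (reflTransGen_tokenStep (hcon a c) (by omega)) hSx hSy
      hTu hTv
  have other : ∀ {x y : W}, lab τ x y = {a, c} → a ∉ (τ x).1 → a ∈ (τ y).1 := by
    intro x y h hx
    have := mem_lab τ (x := x) (y := y) (v := a)
    rw [h] at this
    simp only [Finset.mem_insert, true_or, true_iff] at this
    tauto
  by_cases hx : a ∈ (τ x).1
  · by_cases hu : a ∈ (τ u).1
    · exact key hl h.symm hx hu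
    · exact (key hl (lab_comm τ u v ▸ h.symm) hx (other h.symm hu)).tail
        (.inr ⟨huv.symm, rfl, rfl⟩)
  · refine .head (b := (y, x)) (.inr ⟨hxy, rfl, rfl⟩) ?_
    by_cases hu : a ∈ (τ u).1
    · exact key (lab_comm τ x y ▸ hl) h.symm (other hl hx) hu
    · exact (key (lab_comm τ x y ▸ hl) (lab_comm τ u v ▸ h.symm) (other hl hx)
        (other h.symm hu)).tail (.inr ⟨huv.symm, rfl, rfl⟩)

/-- The labels of the consecutive edges `x y` and `y z` are different and have the vertex `b` in
common. -/
def IsVertexOf (x y z : W) (b : V) : Prop :=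
  ∃ a c, G.Adj b a ∧ G.Adj b c ∧ a ≠ c ∧ lab τ x y = {b, a} ∧ lab τ y z = {b, c}

theorem exists_lab_eq {x : W} {p q : V} (h : p ∈ (τ x).1 ↔ q ∉ (τ x).1) :
    ∃ u, lab τ x u = {p, q} := by
  have hpq : p ≠ q := by
    rintro rfl
    tauto
  have key : ∀ {p q : V}, p ∈ (τ x).1 → q ∉ (τ x).1 → p ≠ q → ∃ u, lab τ x u = {p, q} := by
    intro p q hp hq hpq
    obtain ⟨u, hu⟩ := exists_eq_of_card τ (A := insert q ((τ x).1.erase p))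
      (by rw [Finset.card_insert_of_notMem (by simp [hq]), Finset.card_erase_add_one hp, (τ x).2])
    exact ⟨u, lab_insert τ hpq (by simp) (by simp [hq]) (Finset.insert_erase hp).symm hu⟩
  by_cases hp : p ∈ (τ x).1
  · exact key hp (h.1 hp) hpq
  · rw [Finset.pair_comm]
    exact key (by tauto) hp hpq.symm

/-- If the two labels are disjoint, `x` and `y` agree on the second one, so that move can be made
first, from `x`; this completes an induced square. If the labels meet, `OppositeEdges.disjoint_lab`
forbids a square. -/
theorem wedge_iff (hG : IsC4DiamondFree G) {x y z : W} :
    Wedge Γ x y z ↔ ∃ b, IsVertexOf τ x y z b := by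
  constructor
  · rintro ⟨hxy, hyz, hxz, hno⟩
    have hd : ¬ Disjoint (lab τ x y) (lab τ y z) := by
      intro hd
      obtain ⟨p, q, hpq, hl⟩ := (adj_iff_lab τ).1 hyz
      have hd' := fun v => mem_lab τ (x := x) (y := y) (v := v)
      rw [hl, Finset.disjoint_right] at hd
      have hp := hd (a := p) (by simp)
      have hq := hd (a := q) (by simp)
      obtain ⟨u, hu⟩ := exists_lab_eq τ (x := x) (p := p) (q := q) (by
        have := mem_iff_notMem_of_lab τ hl
        rw [hd'] at hp hq
        tauto)
      refine hno ⟨u, oppositeEdges_of_lab_eq τ hxy hyz ?_ ?_⟩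
      · rwa [hl, Finset.disjoint_right]
      · rw [← lab_trans τ u x z, ← lab_trans τ x y z, hl, lab_comm τ u x, hu, symmDiff_comm,
          symmDiff_symmDiff_cancel_right]
    obtain ⟨b, hb, hb'⟩ := Finset.not_disjoint_iff.1 hd
    obtain ⟨a, hba, hla⟩ := exists_of_mem_lab τ hxy hb
    obtain ⟨c, hbc, hlc⟩ := exists_of_mem_lab τ hyz hb'
    refine ⟨b, a, c, hba, hbc, ?_, hla, hlc⟩
    rintro rfl
    apply hxz
    rw [← lab_eq_empty τ, ← lab_trans τ x y z, hla, hlc, symmDiff_self]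
    rfl
  · rintro ⟨b, a, c, hba, hbc, hac, hla, hlc⟩
    refine ⟨(adj_iff_lab τ).2 ⟨b, a, hba, hla⟩, (adj_iff_lab τ).2 ⟨b, c, hbc, hlc⟩, ?_, ?_⟩
    · rintro rfl
      rw [lab_comm, hlc] at hla
      have : c ∈ ({b, a} : Finset V) := by simp [← hla]
      simp only [Finset.mem_insert, Finset.mem_singleton] at this
      rcases this with h | h
      · exact hbc.ne h.symm
      · exact hac h.symm
    · rintro ⟨u, hu⟩
      have := hu.disjoint_lab τ hG
      rw [hla, hlc] at this
      simp at this

theorem IsVertexOf.mem_iff {x y z : W} {b : V} (h : IsVertexOf τ x y z b) {b' : V} :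
    b' ∈ lab τ x y ∧ b' ∈ lab τ y z ↔ b' = b := by
  obtain ⟨a, c, hba, hbc, hac, hla, hlc⟩ := h
  rw [hla, hlc]
  simp only [Finset.mem_insert, Finset.mem_singleton]
  grind

theorem IsVertexOf.unique {x y z : W} {b b' : V} (h : IsVertexOf τ x y z b)
    (h' : IsVertexOf τ x y z b') : b' = b :=
  (h.mem_iff τ).1 ((h'.mem_iff τ).2 rfl)

/-! ### Realising configurations of `G` and recovering incidence -/

section

variable [Fintype V]

/-- The bound on `k` leaves at least `k - 1` vertices outside any three, enough to park all tokens
but one. -/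
theorem exists_disjoint_of_card (hk : k + 2 ≤ Fintype.card V) {B : Finset V} (hB : B.card ≤ 3) :
    ∃ S : Finset V, S.card = k - 1 ∧ ∀ v ∈ B, v ∉ S := by
  obtain ⟨S, hS, hS'⟩ := Finset.exists_subset_card_eq (s := Bᶜ) (n := k - 1) (by
    rw [Finset.card_compl]
    omega)
  exact ⟨S, hS', fun v hv h => by simpa [hv] using hS h⟩

/-- With the other tokens parked, the last one is put on `a`, `b` and `c` in turn. No adjacency is
assumed, so this serves both wedges and triangles. -/
theorem exists_lab_triple (hk₁ : 1 ≤ k) (hk : k + 2 ≤ Fintype.card V) {a b c : V} (hab : a ≠ b)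
    (hbc : b ≠ c) (hac : a ≠ c) :
    ∃ x y z, lab τ x y = {a, b} ∧ lab τ y z = {b, c} ∧ lab τ x z = {a, c} := by
  obtain ⟨S, hS, hd⟩ := exists_disjoint_of_card hk (B := {a, b, c}) Finset.card_le_three
  have ha := hd a (by simp)
  have hb := hd b (by simp)
  have hc := hd c (by simp)
  obtain ⟨x, hx⟩ := exists_eq_of_card τ (A := insert a S)
    (by rw [Finset.card_insert_of_notMem ha]; omega)
  obtain ⟨y, hy⟩ := exists_eq_of_card τ (A := insert b S)
    (by rw [Finset.card_insert_of_notMem hb]; omega)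
  obtain ⟨z, hz⟩ := exists_eq_of_card τ (A := insert c S)
    (by rw [Finset.card_insert_of_notMem hc]; omega)
  exact ⟨x, y, z, lab_insert τ hab ha hb hx hy, lab_insert τ hbc hb hc hy hz,
    lab_insert τ hac ha hc hx hz⟩

theorem exists_lab_pair (hk₁ : 1 ≤ k) (hk : k + 2 ≤ Fintype.card V) {a b : V} (hab : a ≠ b) :
    ∃ x y, lab τ x y = {a, b} := by
  obtain ⟨S, hS, hd⟩ := exists_disjoint_of_card hk (B := {a, b})
    (Finset.card_le_two.trans (by omega))
  have ha := hd a (by simp)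
  have hb := hd b (by simp)
  obtain ⟨x, hx⟩ := exists_eq_of_card τ (A := insert a S)
    (by rw [Finset.card_insert_of_notMem ha]; omega)
  obtain ⟨y, hy⟩ := exists_eq_of_card τ (A := insert b S)
    (by rw [Finset.card_insert_of_notMem hb]; omega)
  exact ⟨x, y, lab_insert τ hab ha hb hx hy⟩

theorem exists_isVertexOf (hk₁ : 1 ≤ k) (hk : k + 2 ≤ Fintype.card V) {b : V}
    (hb : ∃ a c, G.Adj b a ∧ G.Adj b c ∧ a ≠ c) : ∃ x y z, IsVertexOf τ x y z b := by
  obtain ⟨a, c, hba, hbc, hac⟩ := hb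
  obtain ⟨x, y, z, h₁, h₂, -⟩ := exists_lab_triple τ hk₁ hk hba.ne' hbc.ne hac
  exact ⟨x, y, z, a, c, hba, hbc, hac, by rw [h₁, Finset.pair_comm], h₂⟩

/-- The given edges may be far apart in the token graph; edges with the same labels that do form a
wedge come from moving one token over `a`, `b`, `c`. -/
theorem meet_iff (hG : IsC4DiamondFree G)
    (hcon : ∀ a c : V, (G.induce {v : V | v ∉ ({a, c} : Finset V)}).Preconnected)
    (hk₁ : 1 ≤ k) (hk : k + 2 ≤ Fintype.card V) {x y u v : W} :
    Meet Γ x y u v ↔ ∃ b a c, G.Adj b a ∧ G.Adj b c ∧ a ≠ c ∧ lab τ x y = {b, a} ∧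
      lab τ u v = {b, c} := by
  constructor
  · rintro ⟨p, q, r, hw, h₁, h₂⟩
    obtain ⟨b, a, c, hba, hbc, hac, hla, hlc⟩ := (wedge_iff τ hG).1 hw
    refine ⟨b, a, c, hba, hbc, hac, ?_, ?_⟩
    · rw [← hla]
      exact (h₁.lab_eq τ hG).symm
    · rw [← hlc]
      exact (h₂.lab_eq τ hG).symm
  · rintro ⟨b, a, c, hba, hbc, hac, hla, hlc⟩
    obtain ⟨p, q, r, h₁, h₂, -⟩ := exists_lab_triple τ hk₁ hk hba.ne' hbc.ne hac
    rw [Finset.pair_comm] at h₁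
    have hv : IsVertexOf τ p q r b := ⟨a, c, hba, hbc, hac, h₁, h₂⟩
    exact ⟨p, q, r, (wedge_iff τ hG).2 ⟨b, hv⟩,
      (sameLabel_iff τ hG hcon ((adj_iff_lab τ).2 ⟨b, a, hba, h₁⟩)).2 (h₁.trans hla.symm),
      (sameLabel_iff τ hG hcon ((adj_iff_lab τ).2 ⟨b, c, hbc, h₂⟩)).2 (h₂.trans hlc.symm)⟩

/-- An edge that meets `{b, a}` and `{b, c}` but misses `b` is `{a, c}`, and these three labels
occur on a triangle of the token graph. Three edges at `b` never do: around a triangle the third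
label is the symmetric difference of the others and so misses `b`. -/
theorem inc_iff (hG : IsC4DiamondFree G)
    (hcon : ∀ a c : V, (G.induce {v : V | v ∉ ({a, c} : Finset V)}).Preconnected)
    (hk₁ : 1 ≤ k) (hk : k + 2 ≤ Fintype.card V)
    {x y z u v : W} {b : V} (hv : IsVertexOf τ x y z b) :
    Inc Γ x y z u v ↔ Γ.Adj u v ∧ b ∈ lab τ u v := by
  obtain ⟨a, c, hba, hbc, hac, hla, hlc⟩ := hv
  refine and_congr_right fun huv => ?_
  have hxy : Γ.Adj x y := (adj_iff_lab τ).2 ⟨b, a, hba, hla⟩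
  have hyz : Γ.Adj y z := (adj_iff_lab τ).2 ⟨b, c, hbc, hlc⟩
  rw [sameLabel_iff τ hG hcon hxy, sameLabel_iff τ hG hcon hyz, meet_iff τ hG hcon hk₁ hk,
    meet_iff τ hG hcon hk₁ hk]
  constructor
  · rintro (h | h | ⟨⟨b₁, a₁, c₁, -, hbc₁, hac₁, hla₁, hlc₁⟩, ⟨b₂, a₂, c₂, -, hbc₂, hac₂, hla₂,
      hlc₂⟩, hT⟩)
    · simp [← h, hla]
    · simp [← h, hlc]
    · by_contra hb
      apply hT
      have h₁ : b₁ ∈ ({b, a} : Finset V) := by rw [← hla, hla₁]; simp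
      have h₂ : b₂ ∈ ({b, c} : Finset V) := by rw [← hlc, hla₂]; simp
      have h₁' : b₁ ∈ lab τ u v := by simp [hlc₁]
      have h₂' : b₂ ∈ lab τ u v := by simp [hlc₂]
      simp only [Finset.mem_insert, Finset.mem_singleton] at h₁ h₂
      rcases h₁ with rfl | rfl
      · exact absurd h₁' hb
      rcases h₂ with rfl | rfl
      · exact absurd h₂' hb
      have hl : lab τ u v = {b₁, b₂} := by
        refine (Finset.eq_of_subset_of_card_le (fun w hw => ?_) ?_).symm
        · simp only [Finset.mem_insert, Finset.mem_singleton] at hw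
          rcases hw with rfl | rfl <;> assumption
        · rw [card_lab τ huv, Finset.card_pair hac]
      have hadj := adj_of_lab τ huv hl
      obtain ⟨p, q, r, hp, hq, hr⟩ := exists_lab_triple τ hk₁ hk hba.ne' hbc.ne hac
      have hpq : Γ.Adj p q := (adj_iff_lab τ).2 ⟨_, _, hba.symm, hp⟩
      have hqr : Γ.Adj q r := (adj_iff_lab τ).2 ⟨_, _, hbc, hq⟩
      have hpr : Γ.Adj p r := (adj_iff_lab τ).2 ⟨_, _, hadj, hr⟩
      exact ⟨p, q, r, ⟨hpq, hqr, hpr⟩,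
        (sameLabel_iff τ hG hcon hpq).2 (hp.trans (by rw [hla, Finset.pair_comm])),
        (sameLabel_iff τ hG hcon hqr).2 (hq.trans hlc.symm),
        (sameLabel_iff τ hG hcon hpr).2 (hr.trans hl.symm)⟩
  · intro hb
    obtain ⟨d, hbd, hld⟩ := exists_of_mem_lab τ huv hb
    by_cases hda : a = d
    · exact .inl (by rw [hla, hld, hda])
    by_cases hdc : c = d
    · exact .inr (.inl (by rw [hlc, hld, hdc]))
    refine .inr (.inr ⟨⟨b, a, d, hba, hbd, hda, hla, hld⟩, ⟨b, c, d, hbc, hbd, hdc, hlc, hld⟩, ?_⟩)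
    rintro ⟨p, q, r, -, h₁, h₂, h₃⟩
    have hp := h₁.lab_eq τ hG
    have hq := h₂.lab_eq τ hG
    have hr := h₃.lab_eq τ hG
    simp only at hp hq hr
    have := mem_lab_trans τ (x := p) (y := q) (z := r) (v := b)
    rw [hp, hq, hr, hla, hlc, hld] at this
    simp at this

/-- The test puts `b` into both labels of the second wedge, whose only common element is `b'`. -/
theorem sameVertex_iff (hG : IsC4DiamondFree G)
    (hcon : ∀ a c : V, (G.induce {v : V | v ∉ ({a, c} : Finset V)}).Preconnected)
    (hk₁ : 1 ≤ k) (hk : k + 2 ≤ Fintype.card V)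
    {x y z x' y' z' : W} {b b' : V} (hv : IsVertexOf τ x y z b) (hv' : IsVertexOf τ x' y' z' b') :
    SameVertex Γ x y z x' y' z' ↔ b = b' := by
  rw [SameVertex, inc_iff τ hG hcon hk₁ hk hv, inc_iff τ hG hcon hk₁ hk hv,
    ← hv'.mem_iff τ]
  have := (wedge_iff τ hG).2 ⟨_, hv'⟩
  simp [this.1, this.2.1]

theorem adjVertex_iff (hG : IsC4DiamondFree G)
    (hcon : ∀ a c : V, (G.induce {v : V | v ∉ ({a, c} : Finset V)}).Preconnected)
    (hk₁ : 1 ≤ k) (hk : k + 2 ≤ Fintype.card V)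
    {x y z x' y' z' : W} {b b' : V} (hv : IsVertexOf τ x y z b) (hv' : IsVertexOf τ x' y' z' b') :
    AdjVertex Γ x y z x' y' z' ↔ G.Adj b b' := by
  simp only [AdjVertex, sameVertex_iff τ hG hcon hk₁ hk hv hv', inc_iff τ hG hcon hk₁ hk hv,
    inc_iff τ hG hcon hk₁ hk hv']
  constructor
  · rintro ⟨hne, u, v, ⟨huv, hb⟩, -, hb'⟩
    obtain ⟨d, hbd, hl⟩ := exists_of_mem_lab τ huv hb
    rw [hl, Finset.mem_insert, Finset.mem_singleton] at hb'
    rcases hb' with h | rfl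
    · exact absurd h.symm hne
    · exact hbd
  · intro h
    obtain ⟨u, v, hl⟩ := exists_lab_pair τ hk₁ hk h.ne
    have huv : Γ.Adj u v := (adj_iff_lab τ).2 ⟨_, _, h, hl⟩
    exact ⟨h.ne, u, v, ⟨huv, by simp [hl]⟩, huv, by simp [hl]⟩

end

end Label

/-! ### Complements, minimum degree and the number of vertices -/

/-- Taking complements of sets of vertices. -/
def tokenGraphCompl {V : Type*} [Fintype V] [DecidableEq V] (G : SimpleGraph V) {k : ℕ}
    (hk : k ≤ Fintype.card V) : tokenGraph G k ≃g tokenGraph G (Fintype.card V - k) where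
  toFun A := ⟨A.1ᶜ, by rw [Finset.card_compl, A.2]⟩
  invFun A := ⟨A.1ᶜ, by rw [Finset.card_compl, A.2]; omega⟩
  left_inv A := by simp
  right_inv A := by simp
  map_rel_iff' {A B} := by simp [tokenGraph]

/-- Makes every vertex the centre of a wedge. Deleting at most one other vertex leaves a connected
graph with at least two vertices, so `b` still has a neighbour. -/
theorem exists_two_neighbors {V : Type*} [Fintype V] [DecidableEq V] {G : SimpleGraph V}
    (hG : IsVertexConnected G 3) (b : V) : ∃ a c, G.Adj b a ∧ G.Adj b c ∧ a ≠ c := by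
  have key : ∀ S : Finset V, S.card < 2 → b ∉ S → ∃ a, G.Adj b a ∧ a ∉ S := by
    intro S hS hb
    obtain ⟨w, hw⟩ : ∃ w, w ∉ insert b S := by
      by_contra! h
      have h1 := Finset.card_le_card (fun v _ => h v : (Finset.univ : Finset V) ⊆ insert b S)
      have h2 := Finset.card_insert_le b S
      have h3 := hG.1
      rw [Finset.card_univ] at h1
      omega
    simp only [Finset.mem_insert, not_or] at hw
    have : Nontrivial {v : V | v ∉ S} :=
      ⟨⟨b, hb⟩, ⟨w, hw.2⟩, fun h => hw.1 (Subtype.ext_iff.1 h).symm⟩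
    obtain ⟨a, ha⟩ := (hG.2 S (by omega)).preconnected.exists_adj_of_nontrivial ⟨b, hb⟩
    exact ⟨a.1, ha, a.2⟩
  obtain ⟨a, ha, -⟩ := key ∅ (by simp) (by simp)
  obtain ⟨c, hc, hca⟩ := key {a} (by simp) (by simpa using ha.ne)
  exact ⟨a, c, ha, hc, fun h => hca (by simp [h])⟩

/-- Gives `|V| ≤ N`, so that positions in a list of vertices are digits in base `N`. -/
theorem Nat.le_choose {n k : ℕ} (h₁ : 1 ≤ k) (h₂ : k < n) : n ≤ n.choose k := by
  induction n generalizing k with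
  | zero => omega
  | succ n ih =>
    obtain ⟨k, rfl⟩ := Nat.exists_eq_add_of_le' h₁
    rcases Nat.lt_or_ge (k + 1) n with h | h
    · have := ih (by omega) h
      have := Nat.choose_pos (show k ≤ n by omega)
      rw [Nat.choose_succ_succ']
      omega
    · obtain rfl : n = k + 1 := by omega
      rw [Nat.choose_succ_self_right]

namespace RAM

/-! ### The formulas used by the reconstruction program -/

namespace Fm

/-- Disjunction. -/
def or (φ ψ : Fm) : Fm := .not (.and (.not φ) (.not ψ))

/-- `x` and `y` are adjacent. -/
def adjF (x y : ℕ) : Fm := .rel 0 [x, y]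

/-- `SameLabel`. -/
def sameF (x y u v : ℕ) : Fm := .rel 1 [x, y, u, v]

/-- `OppositeEdges`. -/
def oppF (x y u v : ℕ) : Fm :=
  .and (adjF x y) <| .and (adjF y v) <| .and (adjF u v) <| .and (adjF x u) <|
    .and (.not (.eq x v)) <| .and (.not (adjF x v)) <| .and (.not (.eq y u)) (.not (adjF y u))

/-- `LabelStep`. -/
def stepF (x y u v : ℕ) : Fm :=
  .or (oppF x y u v) (.and (adjF x y) (.and (.eq u y) (.eq v x)))

/-- `Wedge`. -/
def wedgeF (b x y z : ℕ) : Fm :=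
  .and (adjF x y) <| .and (adjF y z) <| .and (.not (.eq x z)) (.not (.ex (oppF x y b z)))

/-- `Meet`. -/
def meetF (b x y u v : ℕ) : Fm :=
  .ex <| .ex <| .ex <| .and (wedgeF (b + 9) b (b + 3) (b + 6)) <|
    .and (sameF b (b + 3) x y) (sameF (b + 3) (b + 6) u v)

/-- `Triangular`. -/
def triangularF (b x y z u v : ℕ) : Fm :=
  .ex <| .ex <| .ex <|
    .and (.and (adjF b (b + 3)) (.and (adjF (b + 3) (b + 6)) (adjF b (b + 6)))) <|
    .and (sameF b (b + 3) x y) (.and (sameF (b + 3) (b + 6) y z) (sameF b (b + 6) u v))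

/-- `Inc`. -/
def incF (b x y z u v : ℕ) : Fm :=
  .and (adjF u v) <| .or (sameF x y u v) <| .or (sameF y z u v) <|
    .and (meetF b x y u v) (.and (meetF b y z u v) (.not (triangularF b x y z u v)))

/-- `SameVertex`. -/
def sameVertexF (b x y z x' y' z' : ℕ) : Fm :=
  .and (incF b x y z x' y') (incF b x y z y' z')

/-- `AdjVertex`. -/
def adjVertexF (b x y z x' y' z' : ℕ) : Fm :=
  .and (.not (sameVertexF b x y z x' y' z')) <|
    .ex <| .ex <| .and (incF (b + 6) x y z b (b + 3)) (incF (b + 6) x' y' z' b (b + 3))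

end Fm

/-- Array `0` contains the adjacency matrix of `F`. -/
def HasAdj {N : ℕ} (F : SimpleGraph (Fin N)) (a : ℕ → ℕ → ℕ) : Prop :=
  ∀ x y : Fin N, a 0 (code N [x.1, y.1]) ≠ 0 ↔ F.Adj x y

/-- Array `1` contains the relation `SameLabel F`. -/
def HasLabels {N : ℕ} (F : SimpleGraph (Fin N)) (a : ℕ → ℕ → ℕ) : Prop :=
  ∀ x y u v : Fin N, a 1 (code N [x.1, y.1, u.1, v.1]) ≠ 0 ↔ SameLabel F (x, y) (u, v)

namespace Fm

variable {N : ℕ} {F : SimpleGraph (Fin N)} {a : ℕ → ℕ → ℕ} {b : ℕ} {e : ℕ → ℕ}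

theorem eval_or {φ ψ : Fm} : (φ.or ψ).Eval a b e ↔ φ.Eval a b e ∨ ψ.Eval a b e := by
  simp only [or, Eval]
  tauto

theorem eval_ex {φ : Fm} (h0 : e 0 = N) :
    φ.ex.Eval a b e ↔ ∃ i : Fin N, φ.Eval a (b + 3) (Function.update e b i) := by
  rw [Eval, h0, Fin.exists_iff]
  simp only [exists_prop]

variable {x y z u v p q r : ℕ} {x' y' z' u' v' p' q' r' : Fin N}

theorem eval_adjF (h0 : e 0 = N) (hF : HasAdj F a) (hx : e x = x') (hy : e y = y') :
    (adjF x y).Eval a b e ↔ F.Adj x' y' := by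
  simp only [adjF, Eval, List.map_cons, List.map_nil, hx, hy, h0]
  exact hF x' y'

theorem eval_sameF (h0 : e 0 = N) (hR : HasLabels F a) (hx : e x = x') (hy : e y = y')
    (hu : e u = u') (hv : e v = v') :
    (sameF x y u v).Eval a b e ↔ SameLabel F (x', y') (u', v') := by
  simp only [sameF, Eval, List.map_cons, List.map_nil, hx, hy, hu, hv, h0]
  exact hR x' y' u' v'

theorem eval_eq (hx : e x = x') (hy : e y = y') : (Fm.eq x y).Eval a b e ↔ x' = y' := by
  rw [Eval, hx, hy, Fin.ext_iff]

theorem eval_oppF (h0 : e 0 = N) (hF : HasAdj F a) (hx : e x = x') (hy : e y = y')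
    (hu : e u = u') (hv : e v = v') :
    (oppF x y u v).Eval a b e ↔ OppositeEdges F x' y' u' v' := by
  -- Only the equations of `Eval` for `not` and `and` are unfolded; the atoms stay intact for their
  -- own lemmas.
  simp only [oppF, Eval.eq_3, Eval.eq_4, eval_adjF h0 hF hx hy, eval_adjF h0 hF hy hv,
    eval_adjF h0 hF hu hv, eval_adjF h0 hF hx hu, eval_adjF h0 hF hx hv, eval_adjF h0 hF hy hu,
    eval_eq hx hv, eval_eq hy hu, OppositeEdges, ne_eq]

theorem eval_stepF (h0 : e 0 = N) (hF : HasAdj F a) (hx : e x = x') (hy : e y = y')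
    (hu : e u = u') (hv : e v = v') :
    (stepF x y u v).Eval a b e ↔ LabelStep F (x', y') (u', v') := by
  simp only [stepF, eval_or, Eval.eq_4, eval_oppF h0 hF hx hy hu hv, eval_adjF h0 hF hx hy,
    eval_eq hu hy, eval_eq hv hx, LabelStep]

/-- The bounds `x < b` and so on keep the quantified register `b` from capturing an argument. -/
theorem eval_wedgeF (hb : 0 < b) (h0 : e 0 = N) (hF : HasAdj F a) (hx : e x = x') (hy : e y = y')
    (hz : e z = z') (hxb : x < b) (hyb : y < b) (hzb : z < b) :
    (wedgeF b x y z).Eval a b e ↔ Wedge F x' y' z' := by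
  simp only [wedgeF, Eval.eq_3, Eval.eq_4, eval_adjF h0 hF hx hy, eval_adjF h0 hF hy hz,
    eval_eq hx hz, Wedge, ne_eq, eval_ex h0]
  have : ∀ w : Fin N, (oppF x y b z).Eval a (b + 3) (Function.update e b w) ↔
      OppositeEdges F x' y' w z' := fun w => eval_oppF
    (by simp (disch := omega) [Function.update_of_ne, h0]) hF
    (by simp (disch := omega) [Function.update_of_ne, hx])
    (by simp (disch := omega) [Function.update_of_ne, hy]) (by simp)
    (by simp (disch := omega) [Function.update_of_ne, hz])
  simp only [this]

theorem eval_meetF (hb : 0 < b) (h0 : e 0 = N) (hF : HasAdj F a) (hR : HasLabels F a)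
    (hx : e x = x') (hy : e y = y') (hu : e u = u') (hv : e v = v') (hxb : x < b) (hyb : y < b)
    (hub : u < b) (hvb : v < b) :
    (meetF b x y u v).Eval a b e ↔ Meet F x' y' u' v' := by
  rw [meetF, eval_ex h0]
  refine exists_congr fun p => ?_
  rw [eval_ex (N := N) (by simp (disch := omega) [Function.update_of_ne, h0])]
  refine exists_congr fun q => ?_
  rw [eval_ex (N := N) (by simp (disch := omega) [Function.update_of_ne, h0])]
  refine exists_congr fun r => and_congr ?_ (and_congr ?_ ?_)
  · apply eval_wedgeF (by omega) _ hF
    all_goals first | omega | simp (disch := omega) [Function.update_of_ne, h0]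
  · apply eval_sameF _ hR
    all_goals simp (disch := omega) [Function.update_of_ne, h0, hx, hy]
  · apply eval_sameF _ hR
    all_goals simp (disch := omega) [Function.update_of_ne, h0, hu, hv]

theorem eval_triangularF (hb : 0 < b) (h0 : e 0 = N) (hF : HasAdj F a) (hR : HasLabels F a)
    (hx : e x = x') (hy : e y = y') (hz : e z = z') (hu : e u = u') (hv : e v = v') (hxb : x < b)
    (hyb : y < b) (hzb : z < b) (hub : u < b) (hvb : v < b) :
    (triangularF b x y z u v).Eval a b e ↔ Triangular F x' y' z' u' v' := by
  rw [triangularF, eval_ex h0]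
  refine exists_congr fun p => ?_
  rw [eval_ex (N := N) (by simp (disch := omega) [Function.update_of_ne, h0])]
  refine exists_congr fun q => ?_
  rw [eval_ex (N := N) (by simp (disch := omega) [Function.update_of_ne, h0])]
  refine exists_congr fun r => and_congr (and_congr ?_ (and_congr ?_ ?_))
    (and_congr ?_ (and_congr ?_ ?_))
  iterate 3
    · apply eval_adjF _ hF
      all_goals simp (disch := omega) [Function.update_of_ne, h0]
  iterate 3
    · apply eval_sameF _ hR
      all_goals simp (disch := omega) [Function.update_of_ne, h0, hx, hy, hz, hu, hv]

theorem eval_incF (hb : 0 < b) (h0 : e 0 = N) (hF : HasAdj F a) (hR : HasLabels F a)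
    (hx : e x = x') (hy : e y = y') (hz : e z = z') (hu : e u = u') (hv : e v = v') (hxb : x < b)
    (hyb : y < b) (hzb : z < b) (hub : u < b) (hvb : v < b) :
    (incF b x y z u v).Eval a b e ↔ Inc F x' y' z' u' v' := by
  simp only [incF, Eval.eq_3, Eval.eq_4, eval_or, eval_adjF h0 hF hu hv,
    eval_sameF h0 hR hx hy hu hv, eval_sameF h0 hR hy hz hu hv,
    eval_meetF hb h0 hF hR hx hy hu hv hxb hyb hub hvb,
    eval_meetF hb h0 hF hR hy hz hu hv hyb hzb hub hvb,
    eval_triangularF hb h0 hF hR hx hy hz hu hv hxb hyb hzb hub hvb, Inc]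

theorem eval_sameVertexF (hb : 0 < b) (h0 : e 0 = N) (hF : HasAdj F a) (hR : HasLabels F a)
    (hx : e x = x') (hy : e y = y') (hz : e z = z') (hp : e p = p') (hq : e q = q')
    (hr : e r = r') (hxb : x < b) (hyb : y < b) (hzb : z < b) (hpb : p < b) (hqb : q < b)
    (hrb : r < b) :
    (sameVertexF b x y z p q r).Eval a b e ↔ SameVertex F x' y' z' p' q' r' := by
  rw [sameVertexF, Eval, eval_incF hb h0 hF hR hx hy hz hp hq hxb hyb hzb hpb hqb,
    eval_incF hb h0 hF hR hx hy hz hq hr hxb hyb hzb hqb hrb, SameVertex]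

theorem eval_adjVertexF (hb : 0 < b) (h0 : e 0 = N) (hF : HasAdj F a) (hR : HasLabels F a)
    (hx : e x = x') (hy : e y = y') (hz : e z = z') (hp : e p = p') (hq : e q = q')
    (hr : e r = r') (hxb : x < b) (hyb : y < b) (hzb : z < b) (hpb : p < b) (hqb : q < b)
    (hrb : r < b) :
    (adjVertexF b x y z p q r).Eval a b e ↔ AdjVertex F x' y' z' p' q' r' := by
  rw [adjVertexF, Eval, Eval,
    eval_sameVertexF hb h0 hF hR hx hy hz hp hq hr hxb hyb hzb hpb hqb hrb, AdjVertex, eval_ex h0]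
  refine and_congr_right fun _ => exists_congr fun s => ?_
  rw [eval_ex (N := N) (by simp (disch := omega) [Function.update_of_ne, h0])]
  refine exists_congr fun t => and_congr ?_ ?_
  all_goals
    apply eval_incF (by omega) _ hF hR
    all_goals first
      | omega
      | simp (disch := omega) [Function.update_of_ne, h0, hx, hy, hz, hp, hq, hr]

end Fm

end RAM

/-- A chain that uses the new arc is cut before its first use and after its last one. -/
theorem Relation.ReflTransGen.of_insert {α : Type*} {r r' : α → α → Prop} {d d' : α}
    (hr : ∀ p q, r' p q → r p q ∨ p = d ∧ q = d') {p q : α} (h : Relation.ReflTransGen r' p q) :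
    Relation.ReflTransGen r p q ∨
      Relation.ReflTransGen r p d ∧ Relation.ReflTransGen r d' q := by
  induction h with
  | refl => exact .inl .refl
  | tail _ h ih =>
    rcases hr _ _ h with h | ⟨rfl, rfl⟩
    · exact ih.imp (·.tail h) fun h' => ⟨h'.1, h'.2.tail h⟩
    · exact .inr ⟨ih.elim id (·.1), .refl⟩

namespace RAM

variable {N : ℕ}

theorem code_fin_inj {l l' : List (Fin N)} (h : l.length = l'.length) :
    code N (l.map Fin.val) = code N (l'.map Fin.val) ↔ l = l' := by
  refine ⟨fun hc => ?_, fun h => by rw [h]⟩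
  refine List.map_injective_iff.2 Fin.val_injective (code_inj (by simpa using h) ?_ ?_ hc)
  all_goals
    intro x hx
    obtain ⟨y, -, rfl⟩ := List.mem_map.1 hx
    exact y.2

theorem code_two_inj {x y x' y' : Fin N} :
    code N [x.1, y.1] = code N [x'.1, y'.1] ↔ x = x' ∧ y = y' := by
  simpa using code_fin_inj (l := [x, y]) (l' := [x', y']) rfl

theorem code_four_inj {x y u v x' y' u' v' : Fin N} :
    code N [x.1, y.1, u.1, v.1] = code N [x'.1, y'.1, u'.1, v'.1] ↔
      x = x' ∧ y = y' ∧ u = u' ∧ v = v' := by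
  simpa using code_fin_inj (l := [x, y, u, v]) (l' := [x', y', u', v']) rfl

/-- A bound for the running time of `setP` on `n` registers. -/
noncomputable def setCost (n : ℕ) : Polynomial ℕ := (n : Polynomial ℕ) * (4 * Polynomial.X + 4) + 4

theorem eval_setCost (n N : ℕ) : (setCost n).eval N = n * (4 * N + 4) + 4 := by
  simp [setCost]

/-! ### Computing the labels -/

/-- Write the equality of pairs into array `1`. -/
def initLabels : Prog := nest 2 1 (setP 0 1 [1, 3, 1, 3] 1 5)

theorem exec_initLabels {s : State} (h0 : s.reg 0 = N) (h1 : ∀ j, s.arr 1 j = 0) :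
    Exec initLabels 1 ((nestCost 2 (setCost 4)).eval N) s fun s' =>
      (∀ c ≠ 1, s'.arr c = s.arr c) ∧ ∀ x y u v : Fin N,
        s'.arr 1 (code N [x.1, y.1, u.1, v.1]) ≠ 0 ↔ x = u ∧ y = v := by
  refine (exec_nest 2 (N := N) one_pos h0 (Inv := fun D a => (∀ c ≠ 1, a c = s.arr c) ∧
    ∀ x y u v : Fin N, a 1 (code N [x.1, y.1, u.1, v.1]) ≠ 0 ↔ [x, y] ∈ D ∧ x = u ∧ y = v)
    ?_ ?_).mono le_rfl le_rfl ?_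
  · simp [h1]
  · rintro D t s₁ ht hf hr ⟨hI₁, hI₂⟩
    obtain ⟨x, y, rfl⟩ := List.length_eq_two.1 ht
    obtain ⟨hx, hy, -⟩ := hr
    have h0₁ : s₁.reg 0 = N := (hf 0 one_pos).trans h0
    refine (exec_setP (by omega) (by simp) ?_).mono le_rfl
      (by rw [eval_setCost, h0₁]; rfl) fun _ _ h => h
    intro s₂ ha _
    simp only [List.map_cons, List.map_nil, hx, hy, h0₁] at ha
    rw [ha]
    refine ⟨fun c hc => ?_, fun p q u v => ?_⟩
    · rw [← hI₁ c hc]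
      funext j
      simp [put, hc]
    · simp only [put, true_and, code_four_inj]
      have := hI₂ p q u v
      split_ifs with h
      · obtain ⟨rfl, rfl, rfl, rfl⟩ := h
        simp
      · rw [this]
        simp only [Set.mem_insert_iff, List.cons.injEq, and_true]
        grind
  · rintro s' - ⟨h₁, h₂⟩
    exact ⟨h₁, fun x y u v => by simpa using h₂ x y u v⟩

/-- The condition for joining two chains of steps by a new step. -/
def joinF : Fm := .and (.sameF 9 11 1 3) (.sameF 5 7 13 15)

/-- Write the reflexive transitive closure of `LabelStep` into array `1`, step by step. -/
def mergeLabels : Prog :=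
  nest 4 1 <| ifP (.stepF 1 3 5 7) 9 <| nest 4 9 <| ifP joinF 17 (setP 0 1 [9, 11, 13, 15] 1 17)

/-- A bound for the running time of the inner loop of `mergeLabels`. -/
noncomputable def joinCost : Polynomial ℕ := nestCost 4 (joinF.cost + setCost 4 + 2)

/-- A bound for the running time of `mergeLabels`. -/
noncomputable def mergeCost : Polynomial ℕ :=
  nestCost 4 ((Fm.stepF 1 3 5 7).cost + joinCost + 2)

/-- The generating steps that belong to a set. -/
def StepIn (F : SimpleGraph (Fin N)) (D : Set (List (Fin N))) (p q : Fin N × Fin N) : Prop :=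
  [p.1, p.2, q.1, q.2] ∈ D ∧ LabelStep F p q

theorem exec_join {F : SimpleGraph (Fin N)} {D : Set (List (Fin N))} {x y u v : Fin N} {s : State}
    (h0 : s.reg 0 = N) (hr : Regs 1 [x, y, u, v] s.reg) (hstep : LabelStep F (x, y) (u, v))
    (h1 : ∀ p q p' q' : Fin N, s.arr 1 (code N [p.1, q.1, p'.1, q'.1]) ≠ 0 ↔
      Relation.ReflTransGen (StepIn F D) (p, q) (p', q')) :
    Exec (nest 4 9 <| ifP joinF 17 (setP 0 1 [9, 11, 13, 15] 1 17)) 9 (joinCost.eval N) s fun s' =>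
      (∀ c ≠ 1, s'.arr c = s.arr c) ∧ ∀ p q p' q' : Fin N,
        s'.arr 1 (code N [p.1, q.1, p'.1, q'.1]) ≠ 0 ↔
          Relation.ReflTransGen (StepIn F (insert [x, y, u, v] D)) (p, q) (p', q') := by
  have hsub : ∀ {p q}, Relation.ReflTransGen (StepIn F D) p q →
      Relation.ReflTransGen (StepIn F (insert [x, y, u, v] D)) p q :=
    fun {p q} h => Relation.ReflTransGen.mono (fun p q h => ⟨.inr h.1, h.2⟩) _ _ h
  obtain ⟨hx, hy, hu, hv, -⟩ := hr
  -- The array is read while it is being overwritten, so its content is only sandwiched: marked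
  -- pairs lie in the new closure, and pairs of the old closure, or visited pairs joined through the
  -- new step by old chains, are marked.
  refine (exec_nest 4 (N := N) (by omega) h0 (Inv := fun D' a => (∀ c ≠ 1, a c = s.arr c) ∧
    (∀ p q p' q' : Fin N, a 1 (code N [p.1, q.1, p'.1, q'.1]) ≠ 0 →
      Relation.ReflTransGen (StepIn F (insert [x, y, u, v] D)) (p, q) (p', q')) ∧
    (∀ p q p' q' : Fin N, Relation.ReflTransGen (StepIn F D) (p, q) (p', q') →
      a 1 (code N [p.1, q.1, p'.1, q'.1]) ≠ 0) ∧
    ∀ p q p' q' : Fin N, [p, q, p', q'] ∈ D' →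
      Relation.ReflTransGen (StepIn F D) (p, q) (x, y) →
      Relation.ReflTransGen (StepIn F D) (u, v) (p', q') →
      a 1 (code N [p.1, q.1, p'.1, q'.1]) ≠ 0) ?_ ?_).mono le_rfl le_rfl ?_
  · exact ⟨fun _ _ => rfl, fun p q p' q' h => hsub ((h1 p q p' q').1 h),
      fun p q p' q' h => (h1 p q p' q').2 h, by simp⟩
  · rintro D' t s₁ ht hf hr ⟨hI₁, hI₂, hI₃, hI₄⟩
    obtain ⟨p, q, p', q', rfl⟩ : ∃ p q p' q', t = [p, q, p', q'] := by
      match t, ht with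
      | [p, q, p', q'], _ => exact ⟨p, q, p', q', rfl⟩
    obtain ⟨hp, hq, hp', hq', -⟩ := hr
    have h0₁ : s₁.reg 0 = N := (hf 0 (by omega)).trans h0
    have hx₁ := (hf 1 (by omega)).trans hx
    have hy₁ := (hf 3 (by omega)).trans hy
    have hu₁ := (hf 5 (by omega)).trans hu
    have hv₁ := (hf 7 (by omega)).trans hv
    simp only [Nat.reduceAdd] at hp hq hp' hq'
    have hev : joinF.Eval s₁.arr 17 s₁.reg ↔ s₁.arr 1 (code N [p.1, q.1, x.1, y.1]) ≠ 0 ∧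
        s₁.arr 1 (code N [u.1, v.1, p'.1, q'.1]) ≠ 0 := by
      simp only [joinF, Fm.sameF, Fm.Eval, List.map_cons, List.map_nil, hp, hq, hp', hq', hx₁, hy₁,
        hu₁, hv₁, h0₁]
    refine (exec_if (A := [1, 3, 5, 7, 9, 11, 13, 15]) (T := (setCost 4).eval N) (by omega)
      (by decide) (by decide) ?_ ?_).mono le_rfl (by simp [h0₁]) fun _ _ h => h
    · intro hφ s₂ ha₂ hf₂
      rw [hev] at hφ
      have h0₂ : s₂.reg 0 = N := (hf₂ 0 (by omega)).trans h0₁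
      refine (exec_setP (by omega) (by decide) ?_).mono le_rfl (by rw [eval_setCost, h0₂]; rfl)
        fun _ _ h => h
      intro s₃ ha₃ _
      simp only [List.map_cons, List.map_nil, hf₂ 9 (by omega), hf₂ 11 (by omega),
        hf₂ 13 (by omega), hf₂ 15 (by omega), hp, hq, hp', hq', h0₂, ha₂] at ha₃
      have hge : ∀ j, s₁.arr 1 j ≠ 0 → s₃.arr 1 j ≠ 0 := by
        intro j hj
        rw [ha₃, put]
        split_ifs <;> simp [hj]
      refine ⟨fun c hc => ?_, fun a b a' b' h => ?_, fun a b a' b' h => hge _ (hI₃ a b a' b' h),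
        fun a b a' b' h h₁ h₂ => ?_⟩
      · rw [← hI₁ c hc, ha₃]
        funext j
        simp [put, hc]
      · rw [ha₃] at h
        simp only [put, true_and, code_four_inj] at h
        split_ifs at h with hc
        · obtain ⟨rfl, rfl, rfl, rfl⟩ := hc
          exact ((hI₂ _ _ _ _ hφ.1).tail ⟨.inl rfl, hstep⟩).trans (hI₂ _ _ _ _ hφ.2)
        · exact hI₂ _ _ _ _ h
      · rcases h with h | h
        · simp only [List.cons.injEq, and_true] at h
          obtain ⟨rfl, rfl, rfl, rfl⟩ := h
          simp [ha₃, put]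
        · exact hge _ (hI₄ a b a' b' h h₁ h₂)
    · intro hφ s₂ ha₂ hf₂
      rw [hev] at hφ
      rw [ha₂]
      refine ⟨hI₁, hI₂, hI₃, fun a b a' b' h h₁ h₂ => ?_⟩
      rcases h with h | h
      · simp only [List.cons.injEq, and_true] at h
        obtain ⟨rfl, rfl, rfl, rfl⟩ := h
        exact absurd ⟨hI₃ _ _ _ _ h₁, hI₃ _ _ _ _ h₂⟩ hφ
      · exact hI₄ a b a' b' h h₁ h₂
  · rintro s' - ⟨h₁, h₂, h₃, h₄⟩
    refine ⟨h₁, fun p q p' q' => ⟨h₂ p q p' q', fun h => ?_⟩⟩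
    rcases h.of_insert (r := StepIn F D) (d := (x, y)) (d' := (u, v)) (fun a b h => by
      rcases h.1 with h' | h'
      · simp only [List.cons.injEq, and_true] at h'
        exact .inr ⟨Prod.ext h'.1 h'.2.1, Prod.ext h'.2.2.1 h'.2.2.2⟩
      · exact .inl ⟨h', h.2⟩) with h | ⟨h, h'⟩
    · exact h₃ _ _ _ _ h
    · exact h₄ _ _ _ _ rfl h h'

/-- The array holds the closure under the generating steps among the visited tuples; a tuple that is
no step leaves this closure unchanged. -/
theorem exec_mergeLabels {F : SimpleGraph (Fin N)} {s : State} (h0 : s.reg 0 = N)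
    (hF : HasAdj F s.arr) (h1 : ∀ x y u v : Fin N,
      s.arr 1 (code N [x.1, y.1, u.1, v.1]) ≠ 0 ↔ x = u ∧ y = v) :
    Exec mergeLabels 1 (mergeCost.eval N) s fun s' =>
      (∀ c ≠ 1, s'.arr c = s.arr c) ∧ HasLabels F s'.arr := by
  refine (exec_nest 4 (N := N) one_pos h0 (Inv := fun D a => (∀ c ≠ 1, a c = s.arr c) ∧
    ∀ p q p' q' : Fin N, a 1 (code N [p.1, q.1, p'.1, q'.1]) ≠ 0 ↔
      Relation.ReflTransGen (StepIn F D) (p, q) (p', q')) ?_ ?_).mono le_rfl le_rfl ?_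
  · refine ⟨fun _ _ => rfl, fun p q p' q' => ?_⟩
    rw [h1, ← Prod.mk.injEq]
    refine ⟨fun h => h ▸ .refl, fun h => ?_⟩
    rcases h.cases_head with h | ⟨_, h, -⟩
    · exact h
    · exact h.1.elim
  · rintro D t s₁ ht hf hr ⟨hI₁, hI₂⟩
    obtain ⟨x, y, u, v, rfl⟩ : ∃ x y u v, t = [x, y, u, v] := by
      match t, ht with
      | [x, y, u, v], _ => exact ⟨x, y, u, v, rfl⟩
    have h0₁ : s₁.reg 0 = N := (hf 0 one_pos).trans h0
    have hF₁ : HasAdj F s₁.arr := by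
      rw [HasAdj, hI₁ 0 (by simp)]
      exact hF
    obtain ⟨hx, hy, hu, hv, -⟩ := id hr
    refine (exec_if (A := [1, 3, 5, 7]) (T := joinCost.eval N) (by omega) (by decide) (by decide)
      ?_ ?_).mono le_rfl (by simp [h0₁]) fun _ _ h => h
    · intro hφ s₂ ha₂ hf₂
      rw [Fm.eval_stepF h0₁ hF₁ hx hy hu hv] at hφ
      refine (exec_join (F := F) (D := D) ((hf₂ 0 (by omega)).trans h0₁) (x := x) (y := y)
        (u := u) (v := v) ?_ hφ (ha₂ ▸ hI₂)).mono le_rfl le_rfl ?_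
      · exact ⟨(hf₂ 1 (by omega)).trans hx, (hf₂ 3 (by omega)).trans hy,
          (hf₂ 5 (by omega)).trans hu, (hf₂ 7 (by omega)).trans hv, trivial⟩
      · rintro s₃ - ⟨h₁, h₂⟩
        exact ⟨fun c hc => (h₁ c hc).trans (by rw [ha₂]; exact hI₁ c hc), h₂⟩
    · intro hφ s₂ ha₂ hf₂
      rw [Fm.eval_stepF h0₁ hF₁ hx hy hu hv] at hφ
      rw [ha₂]
      refine ⟨hI₁, fun p q p' q' => (hI₂ p q p' q').trans ?_⟩
      have : StepIn F (insert [x, y, u, v] D) = StepIn F D := by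
        funext a b
        refine propext ⟨fun h => ⟨h.1.resolve_left fun h' => hφ ?_, h.2⟩,
          fun h => ⟨.inr h.1, h.2⟩⟩
        simp only [List.cons.injEq, and_true] at h'
        obtain ⟨rfl, rfl, rfl, rfl⟩ := h'
        exact h.2
      rw [this]
  · rintro s' - ⟨h₁, h₂⟩
    refine ⟨h₁, fun x y u v => (h₂ x y u v).trans ?_⟩
    have : StepIn F {t | t.length = 4} = LabelStep F := by
      funext a b
      simp [StepIn]
    rw [this, SameLabel]

end RAM

namespace RAM

variable {N : ℕ}

/-! ### Listing the vertices -/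

/-- The wedge in the registers `1`, `3`, `5` determines a vertex that has not been listed. -/
def newF : Fm :=
  .and (.wedgeF 7 1 3 5) <| .not <| .ex <| .ex <| .ex <| .ex <|
    .and (.rel 2 [7, 10, 13, 16]) (.sameVertexF 19 10 13 16 1 3 5)

/-- List the wedge in the registers `1`, `3`, `5`. The number of listed wedges is in cell `0` of
array `3`. -/
def pushVertex : Prog :=
  .seq (.const 7 0) <| .seq (.load 7 3 7) <| .seq (setP 0 2 [7, 1, 3, 5] 1 8) <|
    .seq (.const 8 1) <| .seq (.add 7 7 8) <| .seq (.const 8 0) (.store 3 8 7)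

/-- List one wedge for each vertex in array `2`. -/
def listVertices : Prog := nest 3 1 (ifP newF 7 pushVertex)

/-- A bound for the running time of `listVertices`. -/
noncomputable def listCost : Polynomial ℕ := nestCost 3 (newF.cost + (setCost 4 + 6) + 2)

theorem exec_pushVertex {x y z : Fin N} {s : State} {Q : State → Prop} (h0 : s.reg 0 = N)
    (hr : Regs 1 [x, y, z] s.reg)
    (h : ∀ s', s'.arr = put (put s.arr 2 (code N [s.arr 3 0, x.1, y.1, z.1]) 1) 3 0
      (s.arr 3 0 + 1) → Q s') : Exec pushVertex 7 ((setCost 4 + 6).eval N) s Q := by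
  obtain ⟨hx, hy, hz, -⟩ := hr
  simp only [Nat.reduceAdd] at hx hy hz
  refine Exec.mono (exec_seq (exec_const (by omega) (exec_seq (exec_load (by omega) (exec_seq
    (Exec.mono (b := 8) (T' := (setCost 4).eval N) (Q := fun s₁ => s₁.arr =
      put s.arr 2 (code N [s.arr 3 0, x.1, y.1, z.1]) 1 ∧ s₁.reg 7 = s.arr 3 0)
      (exec_setP (by omega) (by decide) ?_) (by omega) ?_ (Q' := fun s₂ => Exec _ _ 4 s₂ _)
      ?_)))))) le_rfl ?_ fun _ _ h => h
  · intro s₁ ha hf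
    refine ⟨?_, (hf 7 (by omega)).trans (by simp [setReg_reg])⟩
    rw [ha]
    simp [setReg_reg, h0, hx, hy, hz]
  · rw [eval_setCost]
    simp [setReg_reg, h0]
  · rintro s₁ - ⟨ha, h7⟩
    refine exec_seq (exec_const (by omega) (exec_seq (exec_add (by omega) (exec_seq
      (exec_const (by omega) (exec_store (h _ ?_)))))))
    funext c j
    simp [setArr_arr, put, setReg_reg, h7, ha]
  · simp only [Polynomial.eval_add, Polynomial.eval_ofNat]
    omega

section

variable {V : Type*} [DecidableEq V] {G : SimpleGraph V} {F : SimpleGraph (Fin N)} {k : ℕ}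
  (τ : F ≃g tokenGraph G k)

/-- Array `2` contains wedges that determine the vertices in the list, and array `3` contains its
length. -/
def Lists (l : List V) (a : ℕ → ℕ → ℕ) : Prop :=
  a 3 0 = l.length ∧
    (∀ i x y z : Fin N, a 2 (code N [i.1, x.1, y.1, z.1]) ≠ 0 →
      ∃ b, IsVertexOf τ x y z b ∧ l[i.1]? = some b) ∧
    ∀ (i : Fin N) (b : V), l[i.1]? = some b →
      ∃ x y z : Fin N, a 2 (code N [i.1, x.1, y.1, z.1]) ≠ 0

/-- `hN` makes the new position a digit in base `N`, so the new cell differs from the cells of all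
other tuples. -/
theorem Lists.push {l : List V} {a : ℕ → ℕ → ℕ} (h : Lists τ l a) (hN : l.length < N)
    {x y z : Fin N} {b : V} (hb : IsVertexOf τ x y z b) :
    Lists τ (l ++ [b]) (put (put a 2 (code N [a 3 0, x.1, y.1, z.1]) 1) 3 0 (a 3 0 + 1)) := by
  obtain ⟨h₁, h₂, h₃⟩ := h
  rw [h₁]
  have hput : ∀ i p q r : Fin N, put (put a 2 (code N [l.length, x.1, y.1, z.1]) 1) 3 0
      (l.length + 1) 2 (code N [i.1, p.1, q.1, r.1]) =
      if i.1 = l.length ∧ p = x ∧ q = y ∧ r = z then 1 else a 2 (code N [i.1, p.1, q.1, r.1]) := by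
    intro i p q r
    have := code_four_inj (x := i) (y := p) (u := q) (v := r) (x' := ⟨l.length, hN⟩) (y' := x)
      (u' := y) (v' := z)
    simp only [Fin.ext_iff] at this ⊢
    simp [put, this]
  refine ⟨by simp [put], fun i p q r h => ?_, fun i b' h => ?_⟩
  · rw [hput] at h
    split_ifs at h with hc
    · obtain ⟨hi, rfl, rfl, rfl⟩ := hc
      exact ⟨b, hb, by simp [hi]⟩
    · obtain ⟨b', h4, h5⟩ := h₂ i p q r h
      refine ⟨b', h4, ?_⟩
      rw [List.getElem?_append_left (List.getElem?_eq_some_iff.1 h5).1, h5]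
  · by_cases hi : i.1 = l.length
    · exact ⟨x, y, z, by rw [hput]; simp [hi]⟩
    · have hlt := (List.getElem?_eq_some_iff.1 h).1
      rw [List.length_append, List.length_singleton] at hlt
      rw [List.getElem?_append_left (by omega)] at h
      obtain ⟨p, q, r, h'⟩ := h₃ i b' h
      refine ⟨p, q, r, ?_⟩
      rw [hput]
      split_ifs <;> simp [h']

variable [Fintype V]

/-- The list `l` exists only in the proof; the machine sees wedges and compares them by
`sameVertex_iff`. As every vertex is the centre of a wedge, `l` is complete at the end. -/
theorem exec_listVertices (hG : IsC4DiamondFree G)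
    (hcon : ∀ a c : V, (G.induce {v : V | v ∉ ({a, c} : Finset V)}).Preconnected)
    (hk₁ : 1 ≤ k) (hk : k + 2 ≤ Fintype.card V) (hV : Fintype.card V ≤ N)
    (hdeg : ∀ b, ∃ a c, G.Adj b a ∧ G.Adj b c ∧ a ≠ c) {s : State}
    (h0 : s.reg 0 = N) (hF : HasAdj F s.arr) (hR : HasLabels F s.arr) (h2 : ∀ j, s.arr 2 j = 0)
    (h3 : s.arr 3 0 = 0) :
    Exec listVertices 1 (listCost.eval N) s fun s' =>
      (∀ c, c ≠ 2 → c ≠ 3 → s'.arr c = s.arr c) ∧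
        ∃ l : List V, l.Nodup ∧ (∀ b, b ∈ l) ∧ Lists τ l s'.arr := by
  refine (exec_nest 3 (N := N) one_pos h0 (Inv := fun D a =>
    (∀ c, c ≠ 2 → c ≠ 3 → a c = s.arr c) ∧ ∃ l : List V, l.Nodup ∧
      (∀ (x y z : Fin N) (b : V), [x, y, z] ∈ D → IsVertexOf τ x y z b → b ∈ l) ∧ Lists τ l a)
    ?_ ?_).mono le_rfl le_rfl ?_
  · refine ⟨fun _ _ _ => rfl, [], by simp, by simp, by simp [h3], by simp [h2], by simp⟩
  · rintro D t s₁ ht hf hr ⟨hI, l, hl, hD, hL⟩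
    obtain ⟨x, y, z, rfl⟩ := List.length_eq_three.1 ht
    have h0₁ : s₁.reg 0 = N := (hf 0 one_pos).trans h0
    have hF₁ : HasAdj F s₁.arr := by
      rw [HasAdj, hI 0 (by simp) (by simp)]
      exact hF
    have hR₁ : HasLabels F s₁.arr := by
      rw [HasLabels, hI 1 (by simp) (by simp)]
      exact hR
    obtain ⟨hx, hy, hz, -⟩ := id hr
    simp only [Nat.reduceAdd] at hx hy hz
    have hev : newF.Eval s₁.arr 7 s₁.reg ↔ Wedge F x y z ∧ ¬ ∃ i x' y' z' : Fin N,
        s₁.arr 2 (code N [i.1, x'.1, y'.1, z'.1]) ≠ 0 ∧ SameVertex F x' y' z' x y z := by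
      rw [newF, Fm.Eval, Fm.eval_wedgeF (by omega) h0₁ hF₁ hx hy hz (by omega) (by omega)
        (by omega), Fm.Eval, Fm.eval_ex h0₁]
      refine and_congr_right fun _ => not_congr (exists_congr fun i => ?_)
      rw [Fm.eval_ex (N := N) (by simp [h0₁])]
      refine exists_congr fun x' => ?_
      rw [Fm.eval_ex (N := N) (by simp [h0₁])]
      refine exists_congr fun y' => ?_
      rw [Fm.eval_ex (N := N) (by simp [h0₁])]
      refine exists_congr fun z' => and_congr ?_ ?_
      · simp [Fm.Eval, h0₁]
      · apply Fm.eval_sameVertexF (by omega) _ hF₁ hR₁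
        all_goals first | omega | simp [h0₁, hx, hy, hz]
    refine (exec_if (A := [1, 3, 5]) (T := (setCost 4 + 6).eval N) (by omega) (by decide)
      (by decide) ?_ ?_).mono le_rfl (by simp [h0₁]) fun _ _ h => h
    · intro hφ s₂ ha₂ hf₂
      obtain ⟨hw, hnew⟩ := hev.1 hφ
      obtain ⟨b, hb⟩ := (wedge_iff τ hG).1 hw
      have hbl : b ∉ l := by
        intro hbl
        obtain ⟨i, hi, hib⟩ := List.getElem_of_mem hbl
        have hiN : i < N := hi.trans_le (hl.length_le_card.trans hV)
        have hib' : l[i]? = some b := List.getElem?_eq_some_iff.2 ⟨hi, hib⟩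
        obtain ⟨x', y', z', h'⟩ := hL.2.2 ⟨i, hiN⟩ b hib'
        obtain ⟨b', hb', hlb⟩ := hL.2.1 _ _ _ _ h'
        obtain rfl : b = b' := by simpa [hib'] using hlb
        exact hnew ⟨⟨i, hiN⟩, x', y', z', h', (sameVertex_iff τ hG hcon hk₁ hk hb' hb).2 rfl⟩
      have hnd : (l ++ [b]).Nodup := by
        simpa [List.nodup_append] using ⟨hl, fun a ha h => hbl (h ▸ ha)⟩
      -- The extended list has no repetitions either, so its length is at most `|V| ≤ N`.
      have hlen : l.length < N := by
        have := hnd.length_le_card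
        simp only [List.length_append, List.length_singleton] at this
        omega
      refine exec_pushVertex ((hf₂ 0 (by omega)).trans h0₁) (x := x) (y := y) (z := z)
        ⟨(hf₂ 1 (by omega)).trans hx, (hf₂ 3 (by omega)).trans hy, (hf₂ 5 (by omega)).trans hz,
          trivial⟩ ?_
      intro s₃ ha₃
      rw [ha₃, ha₂]
      refine ⟨fun c hc hc' => ?_, l ++ [b], hnd, ?_, hL.push τ hlen hb⟩
      · rw [← hI c hc hc']
        funext j
        simp [put, hc, hc']
      · intro p q r b' h hb'
        rcases h with h | h
        · simp only [List.cons.injEq, and_true] at h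
          obtain ⟨rfl, rfl, rfl⟩ := h
          simp [hb.unique τ hb']
        · simp [hD p q r b' h hb']
    · intro hφ s₂ ha₂ hf₂
      rw [ha₂]
      refine ⟨hI, l, hl, ?_, hL⟩
      intro p q r b h hb
      rcases h with h | h
      · simp only [List.cons.injEq, and_true] at h
        obtain ⟨rfl, rfl, rfl⟩ := h
        rw [hev] at hφ
        push Not at hφ
        obtain ⟨i, x', y', z', h', hs⟩ := hφ ((wedge_iff τ hG).2 ⟨b, hb⟩)
        obtain ⟨b', hb', hlb⟩ := hL.2.1 _ _ _ _ h'
        rw [sameVertex_iff τ hG hcon hk₁ hk hb' hb] at hs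
        exact hs ▸ List.mem_of_getElem? hlb
      · exact hD p q r b h hb
  · rintro s' - ⟨hI, l, hl, hD, hL⟩
    refine ⟨hI, l, hl, fun b => ?_, hL⟩
    obtain ⟨x, y, z, hb⟩ := exists_isVertexOf τ hk₁ hk (hdeg b)
    exact hD x y z b rfl hb

end

end RAM

namespace RAM

variable {N : ℕ}

/-! ### Writing the output -/

/-- The vertices listed with the numbers in the registers `1` and `3` are adjacent. -/
def listedAdjF : Fm :=
  .ex <| .ex <| .ex <| .ex <| .ex <| .ex <| .and (.rel 2 [1, 5, 8, 11]) <|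
    .and (.rel 2 [3, 14, 17, 20]) (.adjVertexF 23 5 8 11 14 17 20)

/-- Write the adjacency matrix of the listed vertices into array `4`. -/
def buildMatrix : Prog := nest 2 1 (ifP listedAdjF 5 (setP 0 4 [1, 3] 1 5))

/-- A bound for the running time of `buildMatrix`. -/
noncomputable def buildCost : Polynomial ℕ := nestCost 2 (listedAdjF.cost + setCost 2 + 2)

/-- Clear array `0`. -/
def clearMatrix : Prog := nest 2 1 (setP 0 0 [1, 3] 0 5)

/-- Write array `4` into array `0`, with the content of register `1` as the length of the rows. -/
def copyMatrix : Prog := nest 2 2 (ifP (.rel 4 [2, 4]) 6 (setP 1 0 [2, 4] 1 6))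

/-- A bound for the running time of `copyMatrix`. -/
noncomputable def copyCost : Polynomial ℕ := nestCost 2 ((Fm.rel 4 [2, 4]).cost + setCost 2 + 2)

/-- Write the adjacency matrix in array `4` into array `0`. -/
def output : Prog :=
  .seq clearMatrix <| .seq (.const 1 0) <| .seq (.load 1 3 1) <| .seq copyMatrix (.copy 0 1)

section

variable {V : Type*} [DecidableEq V] {G : SimpleGraph V} {F : SimpleGraph (Fin N)} {k : ℕ}
  (τ : F ≃g tokenGraph G k)

/-- The vertices number `i` and `j` in the list are adjacent. -/
def ListAdj (G : SimpleGraph V) (l : List V) (i j : ℕ) : Prop :=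
  ∃ b b', l[i]? = some b ∧ l[j]? = some b' ∧ G.Adj b b'

/-- All wedges stored at one position determine the same vertex, so any of them may be used for the
test; positions beyond the list have empty rows. -/
theorem exec_buildMatrix [Fintype V] (hG : IsC4DiamondFree G)
    (hcon : ∀ a c : V, (G.induce {v : V | v ∉ ({a, c} : Finset V)}).Preconnected)
    (hk₁ : 1 ≤ k) (hk : k + 2 ≤ Fintype.card V) {l : List V} {s : State}
    (h0 : s.reg 0 = N) (hF : HasAdj F s.arr) (hR : HasLabels F s.arr) (hL : Lists τ l s.arr)
    (h4 : ∀ j, s.arr 4 j = 0) :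
    Exec buildMatrix 1 (buildCost.eval N) s fun s' => (∀ c ≠ 4, s'.arr c = s.arr c) ∧
      ∀ i j : Fin N, s'.arr 4 (code N [i.1, j.1]) ≠ 0 ↔ ListAdj G l i j := by
  refine (exec_nest 2 (N := N) one_pos h0 (Inv := fun D a => (∀ c ≠ 4, a c = s.arr c) ∧
    ∀ i j : Fin N, a 4 (code N [i.1, j.1]) ≠ 0 ↔ [i, j] ∈ D ∧ ListAdj G l i j)
    ?_ ?_).mono le_rfl le_rfl ?_
  · exact ⟨fun _ _ => rfl, by simp [h4]⟩
  · rintro D t s₁ ht hf hr ⟨hI₁, hI₂⟩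
    obtain ⟨i, j, rfl⟩ := List.length_eq_two.1 ht
    obtain ⟨hi, hj, -⟩ := hr
    simp only [Nat.reduceAdd] at hi hj
    have h0₁ : s₁.reg 0 = N := (hf 0 one_pos).trans h0
    have hF₁ : HasAdj F s₁.arr := by
      rw [HasAdj, hI₁ 0 (by simp)]
      exact hF
    have hR₁ : HasLabels F s₁.arr := by
      rw [HasLabels, hI₁ 1 (by simp)]
      exact hR
    have hev : listedAdjF.Eval s₁.arr 5 s₁.reg ↔ ∃ x y z x' y' z' : Fin N,
        s.arr 2 (code N [i.1, x.1, y.1, z.1]) ≠ 0 ∧ s.arr 2 (code N [j.1, x'.1, y'.1, z'.1]) ≠ 0 ∧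
          AdjVertex F x y z x' y' z' := by
      rw [listedAdjF, Fm.eval_ex h0₁]
      refine exists_congr fun x => ?_
      rw [Fm.eval_ex (N := N) (by simp [h0₁])]
      refine exists_congr fun y => ?_
      rw [Fm.eval_ex (N := N) (by simp [h0₁])]
      refine exists_congr fun z => ?_
      rw [Fm.eval_ex (N := N) (by simp [h0₁])]
      refine exists_congr fun x' => ?_
      rw [Fm.eval_ex (N := N) (by simp [h0₁])]
      refine exists_congr fun y' => ?_
      rw [Fm.eval_ex (N := N) (by simp [h0₁])]
      refine exists_congr fun z' => and_congr ?_ (and_congr ?_ ?_)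
      · simp [Fm.Eval, h0₁, hi, hI₁]
      · simp [Fm.Eval, h0₁, hj, hI₁]
      · apply Fm.eval_adjVertexF (by omega) _ hF₁ hR₁
        all_goals first | omega | simp [h0₁]
    have hφ : listedAdjF.Eval s₁.arr 5 s₁.reg ↔ ListAdj G l i j := by
      rw [hev]
      constructor
      · rintro ⟨x, y, z, x', y', z', h₁, h₂, h₃⟩
        obtain ⟨b, hb, hlb⟩ := hL.2.1 _ _ _ _ h₁
        obtain ⟨b', hb', hlb'⟩ := hL.2.1 _ _ _ _ h₂
        exact ⟨b, b', hlb, hlb', (adjVertex_iff τ hG hcon hk₁ hk hb hb').1 h₃⟩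
      · rintro ⟨b, b', hlb, hlb', hadj⟩
        obtain ⟨x, y, z, h₁⟩ := hL.2.2 i b hlb
        obtain ⟨x', y', z', h₂⟩ := hL.2.2 j b' hlb'
        refine ⟨x, y, z, x', y', z', h₁, h₂, ?_⟩
        obtain ⟨c, hc, hlc⟩ := hL.2.1 _ _ _ _ h₁
        obtain ⟨c', hc', hlc'⟩ := hL.2.1 _ _ _ _ h₂
        obtain rfl : b = c := by simpa [hlb] using hlc
        obtain rfl : b' = c' := by simpa [hlb'] using hlc'
        exact (adjVertex_iff τ hG hcon hk₁ hk hc hc').2 hadj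
    refine (exec_if (A := [1, 3]) (T := (setCost 2).eval N) (by omega) (by decide) (by decide)
      ?_ ?_).mono le_rfl (by simp [h0₁]) fun _ _ h => h
    · intro hφ' s₂ ha₂ hf₂
      have h0₂ : s₂.reg 0 = N := (hf₂ 0 (by omega)).trans h0₁
      refine (exec_setP (by omega) (by decide) ?_).mono le_rfl (by rw [eval_setCost, h0₂]; rfl)
        fun _ _ h => h
      intro s₃ ha₃ _
      simp only [List.map_cons, List.map_nil, hf₂ 1 (by omega), hf₂ 3 (by omega), hi, hj, h0₂,
        ha₂] at ha₃
      rw [ha₃]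
      refine ⟨fun c hc => ?_, fun i' j' => ?_⟩
      · rw [← hI₁ c hc]
        funext j
        simp [put, hc]
      · simp only [put, true_and, code_two_inj, Set.mem_insert_iff, List.cons.injEq, and_true]
        split_ifs with h
        · obtain ⟨rfl, rfl⟩ := h
          simp [hφ.1 hφ']
        · rw [hI₂]
          simp [h]
    · intro hφ' s₂ ha₂ hf₂
      rw [ha₂]
      refine ⟨hI₁, fun i' j' => (hI₂ i' j').trans (and_congr_left fun h => ?_)⟩
      rw [Set.mem_insert_iff, or_iff_right]
      simp only [List.cons.injEq, and_true]
      rintro ⟨rfl, rfl⟩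
      exact hφ' (hφ.2 h)
  · rintro s' - ⟨h₁, h₂⟩
    exact ⟨h₁, fun i j => by simpa using h₂ i j⟩

end

/-- Input and output have different row lengths, so old entries would corrupt the result. Only codes
of pairs below `N` can be nonzero, so clearing those cells suffices. -/
theorem exec_clearMatrix {s : State} (h0 : s.reg 0 = N)
    (h : ∀ c, s.arr 0 c ≠ 0 → ∃ i j : Fin N, c = code N [i.1, j.1]) :
    Exec clearMatrix 1 ((nestCost 2 (setCost 2)).eval N) s fun s' =>
      (∀ c ≠ 0, s'.arr c = s.arr c) ∧ ∀ c, s'.arr 0 c = 0 := by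
  refine (exec_nest 2 (N := N) one_pos h0 (Inv := fun D a => (∀ c ≠ 0, a c = s.arr c) ∧
    ∀ c, a 0 c ≠ 0 → ∃ i j : Fin N, [i, j] ∉ D ∧ c = code N [i.1, j.1]) ?_ ?_).mono le_rfl le_rfl ?_
  · exact ⟨fun _ _ => rfl, by simpa using h⟩
  · rintro D t s₁ ht hf hr ⟨hI₁, hI₂⟩
    obtain ⟨x, y, rfl⟩ := List.length_eq_two.1 ht
    obtain ⟨hx, hy, -⟩ := hr
    have h0₁ : s₁.reg 0 = N := (hf 0 one_pos).trans h0
    refine (exec_setP (by omega) (by simp) ?_).mono le_rfl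
      (by rw [eval_setCost, h0₁]; rfl) fun _ _ h => h
    intro s₂ ha _
    simp only [List.map_cons, List.map_nil, hx, hy, h0₁] at ha
    rw [ha]
    refine ⟨fun c hc => ?_, fun c hc => ?_⟩
    · rw [← hI₁ c hc]
      funext j
      simp [put, hc]
    · simp only [put, true_and] at hc
      split_ifs at hc with h'
      · exact absurd rfl hc
      · obtain ⟨i, j, hD, rfl⟩ := hI₂ c hc
        refine ⟨i, j, ?_, rfl⟩
        rintro (h'' | h'')
        · simp only [List.cons.injEq, and_true] at h''
          exact h' (by rw [h''.1, h''.2])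
        · exact hD h''
  · rintro s' - ⟨h₁, h₂⟩
    refine ⟨h₁, fun c => ?_⟩
    by_contra hc
    obtain ⟨i, j, hij, -⟩ := h₂ c hc
    exact hij rfl

theorem exec_copyMatrix {P : ℕ → ℕ → Prop} {m : ℕ} (hm : m ≤ N) (hP : ∀ i j, P i j → i < m ∧ j < m)
    {s : State} (h0 : s.reg 0 = N) (h1 : s.reg 1 = m) (hz : ∀ c, s.arr 0 c = 0)
    (h4 : ∀ i j : Fin N, s.arr 4 (code N [i.1, j.1]) ≠ 0 ↔ P i j) :
    Exec copyMatrix 2 (copyCost.eval N) s fun s' => ∀ i j : Fin m,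
      (P i j → s'.arr 0 (i * m + j) = 1) ∧ (¬ P i j → s'.arr 0 (i * m + j) = 0) := by
  refine (exec_nest 2 (N := N) two_pos h0 (Inv := fun D a => a 4 = s.arr 4 ∧ ∀ i j : Fin m,
    ([i.castLE hm, j.castLE hm] ∈ D ∧ P i j → a 0 (code m [i.1, j.1]) = 1) ∧
      (¬ P i j → a 0 (code m [i.1, j.1]) = 0)) ?_ ?_).mono le_rfl le_rfl ?_
  · exact ⟨rfl, by simp [hz]⟩
  · rintro D t s₁ ht hf hr ⟨hI₁, hI₂⟩
    obtain ⟨x, y, rfl⟩ := List.length_eq_two.1 ht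
    obtain ⟨hx, hy, -⟩ := hr
    simp only [Nat.reduceAdd] at hx hy
    have h0₁ : s₁.reg 0 = N := (hf 0 two_pos).trans h0
    have h1₁ : s₁.reg 1 = m := (hf 1 one_lt_two).trans h1
    have hφ : (Fm.rel 4 [2, 4]).Eval s₁.arr 6 s₁.reg ↔ P x y := by
      simp only [Fm.Eval, List.map_cons, List.map_nil, hx, hy, h0₁, hI₁]
      exact h4 x y
    refine (exec_if (A := [2, 4]) (T := (setCost 2).eval N) (by omega) (by decide) (by decide)
      ?_ ?_).mono le_rfl (by simp [h0₁]) fun _ _ h => h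
    · intro hφ' s₂ ha₂ hf₂
      have h1₂ : s₂.reg 1 = m := (hf₂ 1 (by omega)).trans h1₁
      refine (exec_setP (by omega) (by decide) ?_).mono le_rfl ?_ fun _ _ h => h
      · intro s₃ ha₃ _
        simp only [List.map_cons, List.map_nil, hf₂ 2 (by omega), hf₂ 4 (by omega), hx, hy, h1₂,
          ha₂] at ha₃
        rw [ha₃]
        have hxy := hφ.1 hφ'
        -- The target index is taken in base `m`; it is injective because pairs that satisfy `P` lie
        -- below `m`.
        obtain ⟨hxm, hym⟩ := hP _ _ hxy
        refine ⟨by rw [← hI₁]; funext j; simp [put], fun i j => ?_⟩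
        have hc := code_two_inj (x := i) (y := j) (x' := ⟨x, hxm⟩) (y' := ⟨y, hym⟩)
        simp only [Fin.ext_iff] at hc
        simp only [put, true_and, hc]
        split_ifs with h
        · refine ⟨fun _ => rfl, fun h' => absurd ?_ h'⟩
          rw [h.1, h.2]
          exact hxy
        · refine ⟨fun h' => (hI₂ i j).1 ⟨h'.1.resolve_left fun h'' => h ?_, h'.2⟩, (hI₂ i j).2⟩
          simp only [List.cons.injEq, and_true] at h''
          exact ⟨congrArg Fin.val h''.1, congrArg Fin.val h''.2⟩
      · rw [eval_setCost, h1₂]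
        simp only [List.length_cons, List.length_nil]
        push_cast
        omega
    · intro hφ' s₂ ha₂ hf₂
      rw [ha₂]
      refine ⟨hI₁, fun i j => ⟨fun h => (hI₂ i j).1 ⟨h.1.resolve_left fun h' => ?_, h.2⟩,
        (hI₂ i j).2⟩⟩
      simp only [List.cons.injEq, and_true] at h'
      apply hφ'
      rw [hφ, ← h'.1, ← h'.2]
      exact h.2
  · rintro s' - ⟨-, h⟩ i j
    have hc : code m [i.1, j.1] = i * m + j := by simp [code]
    rw [← hc]
    exact ⟨fun hp => (h i j).1 ⟨rfl, hp⟩, (h i j).2⟩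

/-- A bound for the running time of `output`. -/
noncomputable def outputCost : Polynomial ℕ := nestCost 2 (setCost 2) + copyCost + 3

/-- The frame is at level `0` because register `0` is overwritten at last; until then it bounds the
loops. -/
theorem exec_output {P : ℕ → ℕ → Prop} {m : ℕ} (hm : m ≤ N) (hP : ∀ i j, P i j → i < m ∧ j < m)
    {s : State} (h0 : s.reg 0 = N) (h3 : s.arr 3 0 = m)
    (h : ∀ c, s.arr 0 c ≠ 0 → ∃ i j : Fin N, c = code N [i.1, j.1])
    (h4 : ∀ i j : Fin N, s.arr 4 (code N [i.1, j.1]) ≠ 0 ↔ P i j) :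
    Exec output 0 (outputCost.eval N) s fun s' => s'.reg 0 = m ∧ ∀ i j : Fin m,
      (P i j → s'.arr 0 (i * m + j) = 1) ∧ (¬ P i j → s'.arr 0 (i * m + j) = 0) := by
  refine Exec.mono (exec_seq ((exec_clearMatrix h0 h).mono (by omega) le_rfl
    (Q' := fun s₂ => Exec _ _ (1 + (1 + (copyCost.eval N + 1))) s₂ _) ?_)) le_rfl ?_ fun _ _ h => h
  · rintro s₁ hf ⟨ha, hz⟩
    have h0₁ : s₁.reg 0 = N := (hf 0 one_pos).trans h0
    refine exec_seq (exec_const (by omega) (exec_seq (exec_load (by omega) (exec_seq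
      ((exec_copyMatrix hm hP ?_ ?_ ?_ ?_).mono (by omega) le_rfl ?_)))))
    · simp [setReg_reg, h0₁]
    · simp [setReg_reg, ha, h3]
    · exact hz
    · rw [setReg_arr, setReg_arr, ha 4 (by simp)]
      exact h4
    · intro s₂ hf₂ h₂
      refine exec_copy le_rfl ⟨?_, h₂⟩
      rw [setReg_reg, if_pos rfl, hf₂ 1 one_lt_two]
      simp [setReg_reg, ha, h3]
  · simp only [outputCost, Polynomial.eval_add, Polynomial.eval_ofNat]
    omega

/-! ### The reconstruction program -/

/-- Reconstruct a graph from one of its token graphs. -/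
def reconstruct : Prog :=
  .seq initLabels <| .seq mergeLabels <| .seq listVertices <| .seq buildMatrix output

/-- A bound for the running time of `reconstruct`. -/
noncomputable def reconstructCost : Polynomial ℕ :=
  nestCost 2 (setCost 4) + mergeCost + listCost + buildCost + outputCost

theorem exec_reconstruct {V : Type*} [Fintype V] [DecidableEq V] {G : SimpleGraph V}
    {F : SimpleGraph (Fin N)} {k : ℕ} (τ : F ≃g tokenGraph G k) (hcon : IsVertexConnected G 3)
    (hG : IsC4DiamondFree G) (hk₁ : 1 ≤ k) (hk : k + 2 ≤ Fintype.card V) :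
    Exec reconstruct 0 (reconstructCost.eval N) (input F) fun s =>
      ∃ l : List V, l.Nodup ∧ (∀ b, b ∈ l) ∧ s.reg 0 = l.length ∧ ∀ i j : Fin l.length,
        (ListAdj G l i j → s.arr 0 (i * l.length + j) = 1) ∧
          (¬ ListAdj G l i j → s.arr 0 (i * l.length + j) = 0) := by
  have hcon₂ : ∀ a c : V, (G.induce {v : V | v ∉ ({a, c} : Finset V)}).Preconnected :=
    fun a c => (hcon.2 _ (Finset.card_le_two.trans_lt (by omega))).preconnected
  have hV : Fintype.card V ≤ N := by
    have h := Fintype.card_congr τ.toEquiv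
    rw [Fintype.card_fin, Fintype.card_finset_len] at h
    rw [h]
    exact Nat.le_choose hk₁ (by omega)
  have hcode : ∀ i j : Fin N, code N [i.1, j.1] = i * N + j := fun i j => by simp [code]
  have h0 : (input F).reg 0 = N := by simp [input]
  have hF : HasAdj F (input F).arr := by
    intro x y
    simp only [input, true_and, ne_eq, ite_eq_right_iff, one_ne_zero, imp_false, not_not]
    constructor
    · rintro ⟨i, j, hij, h⟩
      rw [← hcode, code_two_inj] at h
      rwa [h.1, h.2]
    · exact fun h => ⟨x, y, h, hcode x y⟩
  have hz : ∀ c ≠ 0, ∀ j, (input F).arr c j = 0 := fun c hc j => by simp [input, hc]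
  have hsupp : ∀ c, (input F).arr 0 c ≠ 0 → ∃ i j : Fin N, c = code N [i.1, j.1] := by
    intro c hc
    simp only [input, true_and, ne_eq, ite_eq_right_iff, one_ne_zero, imp_false, not_not] at hc
    obtain ⟨i, j, -, h⟩ := hc
    exact ⟨i, j, h.trans (hcode i j).symm⟩
  refine Exec.mono (exec_seq ((exec_initLabels h0 (hz 1 (by simp))).mono (by omega) le_rfl
    (Q' := fun s₁ => Exec _ _ (mergeCost.eval N + (listCost.eval N + (buildCost.eval N +
      outputCost.eval N))) s₁ _) ?_)) le_rfl ?_ fun _ _ h => h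
  · rintro s₁ hf₁ ⟨ha₁, hR₁⟩
    have h0₁ := (hf₁ 0 one_pos).trans h0
    have hF₁ : HasAdj F s₁.arr := by
      rw [HasAdj, ha₁ 0 (by simp)]
      exact hF
    refine exec_seq ((exec_mergeLabels h0₁ hF₁ hR₁).mono (by omega) le_rfl ?_)
    rintro s₂ hf₂ ⟨ha₂, hR₂⟩
    have h0₂ := (hf₂ 0 one_pos).trans h0₁
    have ha₂' : ∀ c ≠ 1, s₂.arr c = (input F).arr c := fun c hc => (ha₂ c hc).trans (ha₁ c hc)
    have hF₂ : HasAdj F s₂.arr := by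
      rw [HasAdj, ha₂' 0 (by simp)]
      exact hF
    refine exec_seq ((exec_listVertices τ hG hcon₂ hk₁ hk hV (exists_two_neighbors hcon) h0₂ hF₂ hR₂
      ?_ ?_).mono (by omega) le_rfl ?_)
    · rw [ha₂' 2 (by simp)]
      exact hz 2 (by simp)
    · rw [ha₂' 3 (by simp)]
      exact hz 3 (by simp) 0
    rintro s₃ hf₃ ⟨ha₃, l, hnd, hmem, hL⟩
    have h0₃ := (hf₃ 0 one_pos).trans h0₂
    have hF₃ : HasAdj F s₃.arr := by
      rw [HasAdj, ha₃ 0 (by simp) (by simp)]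
      exact hF₂
    have hR₃ : HasLabels F s₃.arr := by
      rw [HasLabels, ha₃ 1 (by simp) (by simp)]
      exact hR₂
    refine exec_seq ((exec_buildMatrix τ hG hcon₂ hk₁ hk h0₃ hF₃ hR₃ hL ?_).mono (by omega)
      le_rfl ?_)
    · rw [ha₃ 4 (by simp) (by simp), ha₂' 4 (by simp)]
      exact hz 4 (by simp)
    rintro s₄ hf₄ ⟨ha₄, hm₄⟩
    refine (exec_output (hnd.length_le_card.trans hV) ?_ ((hf₄ 0 one_pos).trans h0₃) ?_ ?_
      hm₄).mono le_rfl le_rfl ?_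
    · rintro i j ⟨b, b', hb, hb', -⟩
      exact ⟨(List.getElem?_eq_some_iff.1 hb).1, (List.getElem?_eq_some_iff.1 hb').1⟩
    · rw [ha₄ 3 (by simp)]
      exact hL.1
    · rw [ha₄ 0 (by simp), ha₃ 0 (by simp) (by simp), ha₂' 0 (by simp)]
      exact hsupp
    · exact fun s₅ _ h => ⟨l, hnd, hmem, h⟩
  · simp only [reconstructCost, Polynomial.eval_add]
    omega

end RAM

theorem mainTheorem10 :
    ∃ (P : RAM.Prog) (p : Polynomial ℕ),
      ∀ (V : Type*) [Fintype V] [DecidableEq V] (G : SimpleGraph V) (k N : ℕ)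
        (F : SimpleGraph (Fin N)),
        IsVertexConnected G 3 → IsC4DiamondFree G →
        1 ≤ k → k < Fintype.card V →
        Nonempty (F ≃g tokenGraph G k) →
        ∃ (t m : ℕ) (s : RAM.State) (H : SimpleGraph (Fin m)),
          RAM.Runs P (RAM.input F) s t ∧ t ≤ p.eval N ∧
          RAM.Holds s H ∧ Nonempty (H ≃g G) := by
  refine ⟨RAM.reconstruct, RAM.reconstructCost, ?_⟩
  rintro V _ _ G k N F hcon hG hk₁ hk ⟨τ⟩
  have hcard := hcon.1
  have key : ∃ k', 1 ≤ k' ∧ k' + 2 ≤ Fintype.card V ∧ Nonempty (F ≃g tokenGraph G k') := by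
    by_cases h : k + 2 ≤ Fintype.card V
    · exact ⟨k, hk₁, h, ⟨τ⟩⟩
    -- Here `k = |V| - 1`, so the new parameter is `1`, and `1 + 2 ≤ |V|` since `|V| > 3`.
    · exact ⟨Fintype.card V - k, by omega, by omega, ⟨τ.trans (tokenGraphCompl G hk.le)⟩⟩
  obtain ⟨k', hk₁', hk', ⟨τ'⟩⟩ := key
  obtain ⟨s, t, hrun, ht, -, l, hnd, hmem, hs, hH⟩ :=
    RAM.exec_reconstruct τ' hcon hG hk₁' hk'
  have hadj : ∀ i j : Fin l.length, RAM.ListAdj G l i j ↔ G.Adj (l.get i) (l.get j) := by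
    intro i j
    simp [RAM.ListAdj]
  -- The list enumerates the vertices without repetition, so pulling `G` back to positions gives an
  -- isomorphic graph.
  refine ⟨t, l.length, s, G.comap l.get, hrun, ht, ⟨hs, fun i j => ?_⟩,
    ⟨⟨hnd.getEquivOfForallMemList l hmem, Iff.rfl⟩⟩⟩
  rw [SimpleGraph.comap_adj, ← hadj]
  exact hH i j
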